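/- **Theorem 2.** Let $n\ge 0$. The AKNS flows are $$\begin{pmatrix}K_{1,m}\\K_{2,m}\end{pmatrix}=L^m\begin{pmatrix}-q\\ r\end{pmatrix},\qquad L=\begin{pmatrix}-\partial_x+2q\,\partial_x^{-1}r&2q\,\partial_x^{-1}q\\-2r\,\partial_x^{-1}r&\partial_x-2r\,\partial_x^{-1}q\end{pmatrix};$$ they are differential polynomials in $q,r$, where $\partial_x^{-1}$ of an exact differential polynomial is its antiderivative without constant term. For $\sigma,\delta\in\{1,-1\}$ the reverse-$t$ NLS(II) hierarchy is $$q_{t_{2l}}=K_{1,2l}\big|_{\,r(x,t)=\delta q(\sigma x,-t)},\qquad l=1,2,\dots,$$ for a complex function $q(x,t)$ of real variables $x$ and $t=(t_2,t_4,\dots)$. For a matrix $A\in\mathbb C^{2(n+1)\times 2(n+1)}$ and columns $C^\pm\in\mathbb C^{2(n+1)}$ let $$\varphi=\exp\Bigl(\tfrac12Ax+\tfrac12\sum_{j\ge1}A^{2j}t_{2j}\Bigr)C^+,\qquad \psi=\exp\Bigl(-\tfrac12Ax-\tfrac12\sum_{j\ge1}A^{2j}t_{2j}\Bigr)C^-,$$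 for those $t$ for which the series converges, and let $\widehat\varphi^{(s)}$ denote the columns $\varphi,\partial_x\varphi,\dots,\partial_x^s\varphi$ (no column if $s=-1$), and $|\widehat\varphi^{(s)};\widehat\psi^{(s')}|$ the determinant of the matrix with columns $\widehat\varphi^{(s)},\widehat\psi^{(s')}$. (1) Let $T\in\mathbb C^{2(n+1)\times 2(n+1)}$ satisfy $$AT+\sigma TA=0,\qquad T^2=\delta\sigma I,\qquad C^-=TC^+. \tag{$*$}$$ Then $\psi(x,t)=T\varphi(\sigma x,-t)$, and $$q=\frac{2\,|\widehat\varphi^{(n-1)};\widehat\psi^{(n+1)}|}{|\widehat\varphi^{(n)};\widehat\psi^{(n)}|}$$ satisfies all equations of the reverse-$t$ NLS(II) hierarchy at every point $(x,t)$ where the denominator is nonzero. (2) Let $\mathbf K\in\mathbb C^{(n+1)\times(n+1)}$ be arbitrary and $A=\begin{pmatrix}\mathbf K&0\\0&-\mathbf K\end{pmatrix}$. The first two conditions in $(*)$ hold for the following $T$: $\begin{pmatrix}0&-I\\I&0\end{pmatrix}$ if $(\sigma,\delta)=(1,-1)$; $\begin{pmatrix}0&I\\I&0\end{pmatrix}$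 if $(\sigma,\delta)=(1,1)$; $\begin{pmatrix}I&0\\0&-I\end{pmatrix}$ if $(\sigma,\delta)=(-1,-1)$; $\begin{pmatrix}iI&0\\0&-iI\end{pmatrix}$ if $(\sigma,\delta)=(-1,1)$. (3) Let $A$ be as in (2) and $\zeta(k)=\frac12kx+\frac12\sum_{j\ge1}k^{2j}t_{2j}$. If $\mathbf K=\mathrm{Diag}(k_1,\dots,k_{n+1})$ and $C^+=(c_1,\dots,c_{n+1},d_1,\dots,d_{n+1})^T$, then $$\varphi=(c_1e^{\zeta(k_1)},\dots,c_{n+1}e^{\zeta(k_{n+1})},d_1e^{\zeta(-k_1)},\dots,d_{n+1}e^{\zeta(-k_{n+1})})^T.$$ (4) If $\mathbf K$ is the $(n+1)\times(n+1)$ Jordan block with $k$ on the diagonal and $1$ on the subdiagonal, $c,d$ are constants or, more generally, functions analytic at $k$, the series in $\zeta$ converges near $k$, and $C^+=\bigl(c,\frac{\partial_kc}{1!},\dots,\frac{\partial_k^nc}{n!},d,\frac{\partial_kd}{1!},\dots,\frac{\partial_k^nd}{n!}\bigr)^T$, then $$\varphi=\Bigl(ce^{\zeta(k)},\tfrac{\partial_k}{1!}(ce^{\zeta(k)}),\dots,\tfrac{\partial_k^n}{n!}(ce^{\zeta(k)}),de^{\zeta(-k)},\tfrac{\partial_k}{1!}(de^{\zeta(-k)}),\dots,\tfrac{\partial_k^n}{n!}(de^{\zeta(-k)})\Bigr)^T.$$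 -/

import Mathlib

/-- Differential polynomials over `ℂ` in two functions `q`, `r` of `x`: the variable `(0, k)` stands
for `∂ₓᵏ q` and the variable `(1, k)` for `∂ₓᵏ r`. -/
abbrev DiffPoly : Type := MvPolynomial (Fin 2 × ℕ) ℂ

namespace DiffPoly

/-- The function `q` as a differential polynomial. -/
noncomputable def q : DiffPoly := MvPolynomial.X (0, 0)

/-- The function `r` as a differential polynomial. -/
noncomputable def r : DiffPoly := MvPolynomial.X (1, 0)

/-- The total derivative `∂ₓ`. -/
noncomputable def D : Derivation ℂ DiffPoly DiffPoly :=
  MvPolynomial.mkDerivation ℂ fun v => MvPolynomial.X (v.1, v.2 + 1)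

open scoped Classical in
/-- `∂ₓ⁻¹ p`: the antiderivative of `p` without constant term. It is unique by `D_injective`; the
default value for an inexact `p` never occurs in the hierarchy, by `D_dInv_akns`. -/
noncomputable def dInv (p : DiffPoly) : DiffPoly :=
  if h : ∃ s : DiffPoly, D s = p ∧ MvPolynomial.constantCoeff s = 0 then h.choose else 0

/-- The recursion operator
`L = [[-∂ₓ + 2 q ∂ₓ⁻¹ r, 2 q ∂ₓ⁻¹ q], [-2 r ∂ₓ⁻¹ r, ∂ₓ - 2 r ∂ₓ⁻¹ q]]` applied to a column. -/
noncomputable def recOp (u : DiffPoly × DiffPoly) : DiffPoly × DiffPoly :=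
  (-D u.1 + 2 * q * dInv (r * u.1 + q * u.2), D u.2 - 2 * r * dInv (r * u.1 + q * u.2))

/-- The AKNS flows `K_n = (K_{1,n}, K_{2,n}) = Lⁿ (-q, r)`. -/
noncomputable def akns (n : ℕ) : DiffPoly × DiffPoly := recOp^[n] (-q, r)

/-- Two antiderivatives without constant term agree. -/
theorem D_injective (s : DiffPoly) (hs : D s = 0) (h0 : MvPolynomial.constantCoeff s = 0) :
    s = 0 := by
  have comm : ∀ (a : Fin 2) (N : ℕ) (p : DiffPoly), MvPolynomial.pderiv (a, N + 1) (D p) =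
      MvPolynomial.pderiv (a, N) p + D (MvPolynomial.pderiv (a, N + 1) p) := by
    intro a N p
    have h : ⁅MvPolynomial.pderiv (R := ℂ) (a, N + 1), D⁆ = MvPolynomial.pderiv (a, N) := by
      apply MvPolynomial.derivation_ext
      rintro ⟨b, M⟩
      by_cases h1 : M = N <;> by_cases h2 : b = a <;> by_cases h3 : M = N + 1 <;>
        simp [Derivation.commutator_apply, D, MvPolynomial.mkDerivation_X, MvPolynomial.pderiv_X,
          h1, h2, h3]
    have := DFunLike.congr_fun h p
    rw [Derivation.commutator_apply] at this
    rw [← this]; ring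
  have key : s.vars = ∅ := by
    by_contra hne
    obtain ⟨⟨a, N⟩, hv, hmax⟩ :=
      s.vars.exists_max_image (fun v => v.2) (Finset.nonempty_iff_ne_empty.2 hne)
    have hnot : (a, N + 1) ∉ s.vars := fun h => by have := hmax _ h; simp at this
    have h2 := comm a N s
    rw [hs, MvPolynomial.pderiv_eq_zero_of_notMem_vars hnot, map_zero, map_zero, add_zero] at h2
    obtain ⟨m, hm, hmi⟩ := (MvPolynomial.mem_vars_iff_mem_support (a, N)).1 hv
    have hmi : m (a, N) ≠ 0 := by simpa using hmi
    have hc := MvPolynomial.coeff_pderiv (i := (a, N)) s (m - Finsupp.single (a, N) 1)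
    have hle : Finsupp.single (a, N) 1 ≤ m := by
      rw [Finsupp.single_le_iff]; omega
    rw [← h2, tsub_add_cancel_of_le hle, MvPolynomial.coeff_zero] at hc
    rcases mul_eq_zero.1 hc.symm with h | h
    · exact MvPolynomial.mem_support_iff.1 hm h
    · exact Nat.cast_add_one_ne_zero _ h
  rw [MvPolynomial.vars_eq_empty_iff_eq_C.1 key, ← MvPolynomial.constantCoeff_eq, h0, map_zero]

/-- On the flows `K_n` the antiderivative in the recursion exists, so that there `∂ₓ ∂ₓ⁻¹ = 1`. -/
theorem D_dInv_akns (n : ℕ) :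
    D (dInv (r * (akns n).1 + q * (akns n).2)) = r * (akns n).1 + q * (akns n).2 := by
  set u : ℕ → DiffPoly := fun n => (akns n).1 with hu
  set v : ℕ → DiffPoly := fun n => (akns n).2 with hv
  set w : ℕ → DiffPoly := fun n => dInv (r * u n + q * v n) with hw
  have us : ∀ n, u (n + 1) = -D (u n) + 2 * q * w n := fun n => by
    simp only [hu, hw, hv, akns, Function.iterate_succ_apply', recOp]
  have vs : ∀ n, v (n + 1) = D (v n) - 2 * r * w n := fun n => by
    simp only [hu, hw, hv, akns, Function.iterate_succ_apply', recOp]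
  have cD : ∀ p, MvPolynomial.constantCoeff (D p) = 0 := fun p => by
    induction p using MvPolynomial.induction_on with
    | C a => simp [D]
    | add a b ha hb => simp [ha, hb]
    | mul_X a v _ => simp [D, MvPolynomial.mkDerivation_X]
  have cu : ∀ n, MvPolynomial.constantCoeff (u n) = 0 := fun n => by
    cases n with
    | zero => simp [hu, akns, q]
    | succ n => rw [us]; simp [cD, q]
  have good : ∀ n, (∃ s, D s = r * u n + q * v n ∧ MvPolynomial.constantCoeff s = 0) →
      D (w n) = r * u n + q * v n ∧ MvPolynomial.constantCoeff (w n) = 0 := fun n h => by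
    simp only [hw, dInv]
    rw [dif_pos h]
    exact h.choose_spec
  suffices ∀ n, D (w n) = r * u n + q * v n ∧ MvPolynomial.constantCoeff (w n) = 0 from
    (this n).1
  intro n
  induction n using Nat.strong_induction_on with
  | _ n ih =>
    apply good
    cases n with
    | zero => exact ⟨0, by simp [hu, hv, akns, mul_comm], by simp⟩
    | succ n =>
      refine ⟨∑ i ∈ Finset.range (n + 1), (w i * w (n - i) - u i * v (n - i)), ?_, ?_⟩
      · have tel : ∀ k ≤ n + 1, ∑ i ∈ Finset.range k,
            (u i * v (n + 1 - i) - u (i + 1) * v (n + 1 - (i + 1))) =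
            u 0 * v (n + 1) - u k * v (n + 1 - k) := fun k hk => by
          rw [Finset.sum_range_sub' (fun i => u i * v (n + 1 - i))]; simp
        have e : ∀ i ∈ Finset.range (n + 1), D (w i * w (n - i) - u i * v (n - i)) =
            (w i * (r * u (n - i) - q * v (n - i)) - w (n - i) * (r * u i - q * v i))
            - (u i * v (n + 1 - i) - u (i + 1) * v (n + 1 - (i + 1))) := fun i hi => by
          have hi' : i ≤ n := by simpa [Nat.lt_succ_iff] using hi
          have e1 : D (u i) = 2 * q * w i - u (i + 1) := by rw [us]; ring
          have e2 : D (v (n - i)) = v (n + 1 - i) + 2 * r * w (n - i) := by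
            rw [show n + 1 - i = (n - i) + 1 by omega, vs]; ring
          rw [map_sub, Derivation.leibniz, Derivation.leibniz, (ih i (by omega)).1,
            (ih (n - i) (by omega)).1, e1, e2, show n + 1 - (i + 1) = n - i by omega]
          simp only [smul_eq_mul]
          ring
        have hrefl : ∑ i ∈ Finset.range (n + 1), w (n - i) * (r * u i - q * v i) =
            ∑ i ∈ Finset.range (n + 1), w i * (r * u (n - i) - q * v (n - i)) := by
          rw [← Finset.sum_range_reflect]
          refine Finset.sum_congr rfl fun i hi => ?_
          have hi' : i ≤ n := by simpa [Nat.lt_succ_iff] using hi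
          rw [show n + 1 - 1 - i = n - i by omega, show n - (n - i) = i by omega]
        rw [map_sum, Finset.sum_congr rfl e, Finset.sum_sub_distrib, Finset.sum_sub_distrib, hrefl,
          tel (n + 1) le_rfl, sub_self, Nat.sub_self]
        have h0 : u 0 = -q := rfl
        have h1 : v 0 = r := rfl
        rw [h0, h1]
        ring
      · rw [map_sum]
        refine Finset.sum_eq_zero fun i hi => ?_
        have hi' : i ≤ n := by simpa [Nat.lt_succ_iff] using hi
        simp [(ih i (by omega)).2, cu]

end DiffPoly

/-- `exp (½ A x + ½ ∑_{j ≥ 1} A^{2j} t_{2j}) C`. The even times `t₂, t₄, …` form the sequence `t`,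
with `t j` in the role of `t_{2(j+1)}`. -/
noncomputable def phi {N : ℕ} (A : Matrix (Fin N) (Fin N) ℂ) (C : Fin N → ℂ) (x : ℝ) (t : ℕ → ℝ) :
    Fin N → ℂ :=
  (NormedSpace.exp ((1 / 2 : ℂ) • ((x : ℂ) • A) +
    (1 / 2 : ℂ) • ∑' j, (t j : ℂ) • A ^ (2 * (j + 1)))).mulVec C

/-- `exp (-½ A x - ½ ∑_{j ≥ 1} A^{2j} t_{2j}) C`. -/
noncomputable def psi {N : ℕ} (A : Matrix (Fin N) (Fin N) ℂ) (C : Fin N → ℂ) (x : ℝ) (t : ℕ → ℝ) :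
    Fin N → ℂ :=
  (NormedSpace.exp (-((1 / 2 : ℂ) • ((x : ℂ) • A)) -
    (1 / 2 : ℂ) • ∑' j, (t j : ℂ) • A ^ (2 * (j + 1)))).mulVec C

/-- The series `∑_{j ≥ 1} A^{2j} t_{2j}` converges (e.g. finitely many times are nonzero). -/
def TimesConverge {N : ℕ} (A : Matrix (Fin N) (Fin N) ℂ) (t : ℕ → ℝ) : Prop :=
  Summable fun j => (t j : ℂ) • A ^ (2 * (j + 1))

/-- The double Wronskian at `x` with columns `φ, ∂ₓφ, …, ∂ₓ^{a-1}φ; ψ, ∂ₓψ, …, ∂ₓ^{N-a-1}ψ`. -/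
noncomputable def doubleWronskian {N : ℕ} (a : ℕ) (φ ψ : ℝ → Fin N → ℂ) (x : ℝ) : ℂ :=
  Matrix.det (Matrix.of fun i j : Fin N =>
    if (j : ℕ) < a then iteratedDeriv j (fun y => φ y i) x
    else iteratedDeriv (j - a) (fun y => ψ y i) x)

/-- `|φ̂⁽ⁿ⁾; ψ̂⁽ⁿ⁾|`, with `2(n+1)` rows. -/
noncomputable def wronskF {n : ℕ} (A : Matrix (Fin (n + 1 + (n + 1))) (Fin (n + 1 + (n + 1))) ℂ)
    (Cp Cm : Fin (n + 1 + (n + 1)) → ℂ) (x : ℝ) (t : ℕ → ℝ) : ℂ :=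
  doubleWronskian (n + 1) (fun y => phi A Cp y t) (fun y => psi A Cm y t) x

/-- `|φ̂⁽ⁿ⁻¹⁾; ψ̂⁽ⁿ⁺¹⁾|`, with `2(n+1)` rows (no `φ` column if `n = 0`). -/
noncomputable def wronskH {n : ℕ} (A : Matrix (Fin (n + 1 + (n + 1))) (Fin (n + 1 + (n + 1))) ℂ)
    (Cp Cm : Fin (n + 1 + (n + 1)) → ℂ) (x : ℝ) (t : ℕ → ℝ) : ℂ :=
  doubleWronskian n (fun y => phi A Cp y t) (fun y => psi A Cm y t) x

/-- At the point `(x, t)` the function `q` satisfies all equations `q_{t_{2l}} = K_{1,2l}`,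
`l = 1, 2, …`, of the reverse-`t` NLS hierarchy, where `r(x,t) = δ q(σx,-t)`. The time derivatives
are part of the claim, and so is the smoothness in `x` of the functions `q` and `r`. -/
def SolvesReverseTimeNLSAt (σ δ : ℝ) (q : ℝ → (ℕ → ℝ) → ℂ) (x : ℝ) (t : ℕ → ℝ) : Prop :=
  let r : ℝ → (ℕ → ℝ) → ℂ := fun y s => (δ : ℂ) * q (σ * y) (-s)
  ContDiffAt ℝ ((⊤ : ℕ∞) : WithTop ℕ∞) (fun y => q y t) x ∧
  ContDiffAt ℝ ((⊤ : ℕ∞) : WithTop ℕ∞) (fun y => r y t) x ∧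
  ∀ j : ℕ, HasDerivAt (fun s => q x (Function.update t j s))
    (MvPolynomial.eval
      (fun v : Fin 2 × ℕ => iteratedDeriv v.2 (fun y => if v.1 = 0 then q y t else r y t) x)
      (DiffPoly.akns (2 * (j + 1))).1) (t j)

/-- The conditions `A T + σ T A = 0` and `T² = δσ I`. -/
def NLSConstraint {N : ℕ} (σ δ : ℝ) (A T : Matrix (Fin N) (Fin N) ℂ) : Prop :=
  A * T + (σ : ℂ) • (T * A) = 0 ∧ T ^ 2 = ((δ * σ : ℝ) : ℂ) • (1 : Matrix (Fin N) (Fin N) ℂ)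

/-- The block matrix `[[M₁, M₂], [M₃, M₄]]`. -/
def blockMatrix {m : ℕ} (M₁ M₂ M₃ M₄ : Matrix (Fin m) (Fin m) ℂ) :
    Matrix (Fin (m + m)) (Fin (m + m)) ℂ :=
  Matrix.reindex finSumFinEquiv finSumFinEquiv (Matrix.fromBlocks M₁ M₂ M₃ M₄)

/-- The Jordan block with `k` on the diagonal and `1` on the subdiagonal. -/
def jordanBlock (m : ℕ) (k : ℂ) : Matrix (Fin m) (Fin m) ℂ :=
  Matrix.of fun i j => if i = j then k else if (i : ℕ) = j + 1 then 1 else 0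

/-- `ζ(k) = ½ k x + ½ ∑_{j ≥ 1} k^{2j} t_{2j}`. -/
noncomputable def zeta (x : ℝ) (t : ℕ → ℝ) (k : ℂ) : ℂ :=
  1 / 2 * k * x + 1 / 2 * ∑' j, k ^ (2 * (j + 1)) * t j

/-- The column `(g, ∂ₖg / 1!, …, ∂ₖ^{m-1}g / (m-1)!)` at `k`. -/
noncomputable def taylorColumn (m : ℕ) (g : ℂ → ℂ) (k : ℂ) : Fin m → ℂ :=
  fun i => iteratedDeriv i g k / (Nat.factorial i : ℂ)

/-! Put `φ` and `ψ` as columns into a frame `Y`. It satisfies `∂ₓY = A Y σ₃/2`, and along `t_k` (`k`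
even) `∂Y = A^k Y σ₃/2`. The denominator is, up to a nonzero constant, the determinant of the
columns `A^jφ, A^jψ`, `j ≤ n`. Where it is nonzero, Cramer's rule gives a unique monic relation `∑
A^{n+1-j} Y W_j = 0` with 2×2 coefficients. Regard `W = 1 + W₁X + …` as a power series in the
inverse spectral parameter `X`, so that `X⁻¹` acts on `Y` as `A`. Then the quotient `q` is `-(W₁)₀₁`
(`wronskH_div_wronskF`).

Let `Z = W⁻¹ (σ₃/2) W`. Differentiating the relation and using its uniqueness gives the Sato–Wilson
equation: `W'` is `-W` times the part of `X^{-k} Z` with positive powers of `X` (`dressing_flow`).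
Its first coefficient says `∂q = (Z_{k+1})₀₁` along the `k`-th flow. For `k = 1` it yields a Lax
equation for `Z` in `x`. Its off-diagonal entries are the differential steps of the AKNS recursion.
The diagonal of `Z` is fixed algebraically by `Z² = 1/4`, and the antiderivatives in the recursion
obey the same quadratic identity (`aknsInt_succ`), so no integration constants can enter. Hence
`(Z_{k+1})₀₁` is the value of `K_{1,k}` at `q = -(W₁)₀₁`, `r = (W₁)₁₀`
(`coeff_dressedSigma_eq_akns`).

It remains to see that `r(x,t) = δ q(σx,-t)`. The matrix `T` carries the frame at `(x,t)` to the one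
at `(σx,-t)` with the columns exchanged, and uniqueness of the relation transports its coefficients
(`NLSConstraint.krylovCoeff_reflect`).

For a Jordan block, the column of Taylor coefficients of `f` at `k` is sent to that of `κ f(κ)`.
Thus the series in the block acts as multiplication by `ζ`, and its exponential as multiplication by
`exp ζ`. -/

open PowerSeries

/-! ### Formal dressing: the conjugate `Z` of `σ₃/2` and its Lax equation. -/

/-- The matrix `σ₃ / 2`. -/
noncomputable def halfSigma : Matrix (Fin 2) (Fin 2) ℂ := Matrix.diagonal ![1 / 2, -(1 / 2)]

/-- `F'` is the coefficientwise derivative at `s` of the family `F` of matrix power series. -/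
def HasCoeffDerivAt (F : ℝ → PowerSeries (Matrix (Fin 2) (Fin 2) ℂ))
    (F' : PowerSeries (Matrix (Fin 2) (Fin 2) ℂ)) (s : ℝ) : Prop :=
  ∀ j a b, HasDerivAt (fun y => coeff j (F y) a b) (coeff j F' a b) s

namespace HasCoeffDerivAt

variable {F G : ℝ → PowerSeries (Matrix (Fin 2) (Fin 2) ℂ)}
  {F' G' : PowerSeries (Matrix (Fin 2) (Fin 2) ℂ)} {s : ℝ}

theorem const (c : PowerSeries (Matrix (Fin 2) (Fin 2) ℂ)) :
    HasCoeffDerivAt (fun _ => c) 0 s := fun j a b => by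
  simpa using hasDerivAt_const s (coeff j c a b)

theorem mul (hF : HasCoeffDerivAt F F' s) (hG : HasCoeffDerivAt G G' s) :
    HasCoeffDerivAt (fun y => F y * G y) (F' * G s + F s * G') s := fun j a b => by
  simp only [map_add, coeff_mul, Matrix.add_apply, Matrix.sum_apply, Matrix.mul_apply,
    ← Finset.sum_add_distrib]
  exact HasDerivAt.fun_sum fun p _ => HasDerivAt.fun_sum fun k _ =>
    (hF p.1 a k).mul (hG p.2 k b)

theorem unique (h : HasCoeffDerivAt F F' s) (h' : HasCoeffDerivAt F G' s) : F' = G' := by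
  ext j a b
  exact (h j a b).unique (h' j a b)

/-- As the leading coefficient is 1, each coefficient of the inverse is a polynomial in those of `F`
and earlier ones of `G`. Only existence is needed: the derivative of `Z` is later found from `W Z =
(σ₃/2) W`. -/
theorem exists_inv (hF : HasCoeffDerivAt F F' s) (hG : ∀ y, F y * G y = 1)
    (h1 : ∀ y, constantCoeff (F y) = 1) : ∃ G', HasCoeffDerivAt G G' s := by
  have hd : ∀ j a b, DifferentiableAt ℝ (fun y => coeff j (G y) a b) s := by
    intro j
    induction j using Nat.strong_induction_on with
    | _ j ih =>
      intro a b
      have e : (fun y => coeff j (G y) a b) = fun y =>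
          coeff j (1 : PowerSeries (Matrix (Fin 2) (Fin 2) ℂ)) a b -
            ∑ i ∈ Finset.range j, ∑ k, coeff (i + 1) (F y) a k * coeff (j - (i + 1)) (G y) k b := by
        funext y
        rw [← hG y, coeff_mul, Finset.Nat.sum_antidiagonal_eq_sum_range_succ
          (fun i l => coeff i (F y) * coeff l (G y)), Finset.sum_range_succ']
        simp [Matrix.add_apply, Matrix.sum_apply, Matrix.mul_apply, h1]
      rw [e]
      refine (differentiableAt_const _).sub (DifferentiableAt.fun_sum fun i hi =>
        DifferentiableAt.fun_sum fun k _ => (hF (i + 1) a k).differentiableAt.mul ?_)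
      have := Finset.mem_range.1 hi
      exact ih _ (by omega) k b
  refine ⟨mk fun j => Matrix.of fun a b => deriv (fun y => coeff j (G y) a b) s, fun j a b => ?_⟩
  simpa using (hd j a b).hasDerivAt

end HasCoeffDerivAt

/-- The conjugate `W⁻¹ (σ₃ / 2) W` of `σ₃ / 2` by a power series with constant coefficient `1`. -/
noncomputable def dressedSigma (W : PowerSeries (Matrix (Fin 2) (Fin 2) ℂ)) :
    PowerSeries (Matrix (Fin 2) (Fin 2) ℂ) :=
  invOfUnit W 1 * C halfSigma * W

section

variable {W : PowerSeries (Matrix (Fin 2) (Fin 2) ℂ)} (hW : constantCoeff W = 1)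
include hW

theorem mul_dressedSigma : W * dressedSigma W = C halfSigma * W := by
  rw [dressedSigma, ← mul_assoc, ← mul_assoc, mul_invOfUnit _ _ (by simpa using hW), one_mul]

theorem dressedSigma_sq : dressedSigma W * dressedSigma W = C ((1 / 4 : ℂ) • 1) := by
  have h : halfSigma * halfSigma = (1 / 4 : ℂ) • 1 := by
    ext i j; fin_cases i <;> fin_cases j <;> norm_num [halfSigma]
  have hc : C ((1 / 4 : ℂ) • (1 : Matrix (Fin 2) (Fin 2) ℂ)) * W =
      W * C ((1 / 4 : ℂ) • (1 : Matrix (Fin 2) (Fin 2) ℂ)) := by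
    ext1 j; simp
  calc dressedSigma W * dressedSigma W
      = invOfUnit W 1 * C halfSigma * (W * dressedSigma W) := by
        simp only [dressedSigma, mul_assoc]
    _ = invOfUnit W 1 * (C (halfSigma * halfSigma) * W) := by
        rw [mul_dressedSigma hW, map_mul]; simp only [mul_assoc]
    _ = _ := by
        rw [h, hc, ← mul_assoc, invOfUnit_mul _ _ (by simpa using hW), one_mul]

theorem coeff_zero_dressedSigma : coeff 0 (dressedSigma W) = halfSigma := by
  simp [dressedSigma, hW]

theorem coeff_one_dressedSigma :
    coeff 1 (dressedSigma W) = halfSigma * coeff 1 W - coeff 1 W * halfSigma := by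
  have h := congrArg (coeff 1) (mul_dressedSigma hW)
  rw [coeff_mul, coeff_C_mul, Finset.Nat.sum_antidiagonal_eq_sum_range_succ
    (fun i l => coeff i W * coeff l (dressedSigma W)), Finset.sum_range_succ,
    Finset.sum_range_one] at h
  simp only [coeff_zero_dressedSigma hW, Nat.sub_self, Nat.sub_zero, coeff_zero_eq_constantCoeff,
    hW, one_mul] at h
  rw [← h, add_sub_cancel_right]

theorem coeff_one_dressedSigma_diag (a : Fin 2) : coeff 1 (dressedSigma W) a a = 0 := by
  rw [coeff_one_dressedSigma hW]
  fin_cases a <;> simp [halfSigma, mul_comm]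

theorem coeff_one_dressedSigma_zero_one : coeff 1 (dressedSigma W) 0 1 = coeff 1 W 0 1 := by
  rw [coeff_one_dressedSigma hW]
  simp [halfSigma]; ring

theorem coeff_one_dressedSigma_one_zero : coeff 1 (dressedSigma W) 1 0 = -coeff 1 W 1 0 := by
  rw [coeff_one_dressedSigma hW]
  simp [halfSigma]; ring

/-- The diagonal of `Z² = 1/4`, read in the domain `ℂ⟦X⟧`, gives `(Z₀₀ - Z₁₁)(Z₀₀ + Z₁₁) = 0`. The
first factor has constant term 1. -/
theorem coeff_dressedSigma_trace (j : ℕ) :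
    coeff j (dressedSigma W) 1 1 = -coeff j (dressedSigma W) 0 0 := by
  set Z := dressedSigma W with hZ
  let E : Fin 2 → Fin 2 → PowerSeries ℂ := fun a b => mk fun j => coeff j Z a b
  have key : ∀ a b, E a 0 * E 0 b + E a 1 * E 1 b = C (((1 / 4 : ℂ) • 1 : Matrix _ _ ℂ) a b) := by
    intro a b
    ext j
    have h : coeff j (Z * Z) a b = coeff j (C ((1 / 4 : ℂ) • (1 : Matrix (Fin 2) (Fin 2) ℂ))) a b := by
      rw [hZ, dressedSigma_sq hW]
    rw [coeff_mul] at h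
    simp only [Matrix.sum_apply, Matrix.mul_apply, Fin.sum_univ_two,
      Finset.sum_add_distrib] at h
    simp only [E, map_add, coeff_mul, coeff_mk, h, coeff_C]
    split_ifs <;> rfl
  have h0 : (E 0 0 - E 1 1) * (E 0 0 + E 1 1) = 0 := by
    have h1 := key 0 0
    have h2 := key 1 1
    simp only [Matrix.smul_apply, Matrix.one_apply_eq] at h1 h2
    linear_combination h1 - h2
  have hne : E 0 0 - E 1 1 ≠ 0 := fun h => by
    have := congrArg (coeff 0) h
    simp only [E, map_sub, coeff_mk, hZ, coeff_zero_dressedSigma hW] at this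
    norm_num [halfSigma] at this
  have := congrArg (coeff j) ((mul_eq_zero.1 h0).resolve_left hne)
  simp only [E, map_add, coeff_mk, map_zero] at this
  linear_combination this

/-- The determinant of `W⁻¹ (σ₃ / 2) W` is `-1/4`. -/
theorem coeff_dressedSigma_det (n : ℕ) :
    -coeff (n + 2) (dressedSigma W) 0 0 = ∑ i ∈ Finset.range (n + 1),
      (coeff (i + 1) (dressedSigma W) 0 0 * coeff (n - i + 1) (dressedSigma W) 0 0 +
        coeff (i + 1) (dressedSigma W) 0 1 * coeff (n - i + 1) (dressedSigma W) 1 0) := by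
  have h : coeff (n + 2) (dressedSigma W * dressedSigma W) 0 0 =
      coeff (n + 2) (C ((1 / 4 : ℂ) • (1 : Matrix (Fin 2) (Fin 2) ℂ))) 0 0 := by
    rw [dressedSigma_sq hW]
  rw [coeff_mul, Finset.Nat.sum_antidiagonal_eq_sum_range_succ
    (fun i l => coeff i (dressedSigma W) * coeff l (dressedSigma W)), Finset.sum_range_succ,
    Finset.sum_range_succ', coeff_C, if_neg (by omega)] at h
  simp only [Matrix.add_apply, Matrix.sum_apply, Matrix.mul_apply, Fin.sum_univ_two,
    coeff_zero_dressedSigma hW, Nat.sub_self, Nat.sub_zero] at h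
  rw [Finset.sum_congr rfl fun i hi => show _ =
    (coeff (i + 1) (dressedSigma W) 0 0 * coeff (n - i + 1) (dressedSigma W) 0 0 +
        coeff (i + 1) (dressedSigma W) 0 1 * coeff (n - i + 1) (dressedSigma W) 1 0) by
      have := Finset.mem_range.1 hi
      rw [show n + 2 - (i + 1) = n - i + 1 by omega]] at h
  -- The two extreme terms of the convolution pair `Z_{n+2}` with `Z₀ = σ₃/2` and contribute one
  -- half of its entry each.
  simp [halfSigma] at h
  linear_combination -h

end

/-- The evolution of `W⁻¹ (σ₃ / 2) W` under the first flow: the AKNS spectral problem. -/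
theorem HasCoeffDerivAt.dressedSigma {W : ℝ → PowerSeries (Matrix (Fin 2) (Fin 2) ℂ)}
    {W' : PowerSeries (Matrix (Fin 2) (Fin 2) ℂ)} {s : ℝ} (hW : ∀ y, constantCoeff (W y) = 1)
    (h : HasCoeffDerivAt W W' s)
    (hflow : X * W' = -(W s * (dressedSigma (W s) - C halfSigma -
      X * C (coeff 1 (dressedSigma (W s)))))) (j : ℕ) (a b : Fin 2) :
    HasDerivAt (fun y => coeff j (_root_.dressedSigma (W y)) a b)
      ((coeff (j + 1) (_root_.dressedSigma (W s)) * halfSigma -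
        halfSigma * coeff (j + 1) (_root_.dressedSigma (W s)) +
        (coeff j (_root_.dressedSigma (W s)) * coeff 1 (_root_.dressedSigma (W s)) -
        coeff 1 (_root_.dressedSigma (W s)) * coeff j (_root_.dressedSigma (W s)))) a b) s := by
  obtain ⟨V', hV⟩ := h.exists_inv (G := fun y => invOfUnit (W y) 1)
    (fun y => mul_invOfUnit _ _ (by simpa using hW y)) hW
  obtain ⟨Z', hZ⟩ : ∃ Z', HasCoeffDerivAt (fun y => _root_.dressedSigma (W y)) Z' s :=
    ⟨_, (hV.mul (.const _)).mul h⟩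
  -- Differentiate `W Z = (σ₃/2) W`. Multiplying by `X`, inserting the flow and cancelling `W`
  -- leaves the Lax equation `X Z' = [Z, U]`, where `U = σ₃/2 + X Z₁`.
  have e1 := h.mul hZ
  simp only [mul_dressedSigma (hW _)] at e1
  have e2 := e1.unique ((HasCoeffDerivAt.const (C halfSigma)).mul h)
  rw [zero_mul, zero_add] at e2
  have hws := mul_dressedSigma (hW s)
  set Z := _root_.dressedSigma (W s) with hZdef
  set U := C halfSigma + X * C (coeff 1 Z) with hU
  have hflow' : X * W' = -(W s * (Z - U)) := by rw [hflow, hU, sub_sub]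
  have e3 : W s * (X * Z') = W s * (Z * U - U * Z) := by
    have h1 : W s * (X * Z') = X * (W s * Z') := by
      rw [← mul_assoc, ← mul_assoc, (commute_X (W s)).eq]
    have h2 : X * (W s * Z') = X * (C halfSigma * W') - X * (W' * Z) := by
      rw [← e2, ← mul_sub, add_sub_cancel_left]
    have h3 : X * (C halfSigma * W') = C halfSigma * (X * W') := by
      rw [← mul_assoc, ← mul_assoc, (commute_X (C halfSigma)).eq]
    rw [h1, h2, h3, ← mul_assoc X, hflow', mul_neg, ← mul_assoc, ← hws]
    noncomm_ring
  have e4 : X * Z' = Z * U - U * Z := by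
    have := congrArg (fun P => invOfUnit (W s) 1 * P) e3
    simpa only [← mul_assoc, invOfUnit_mul (W s) 1 (by simpa using hW s), one_mul] using this
  have e5 : coeff j Z' = coeff (j + 1) Z * halfSigma - halfSigma * coeff (j + 1) Z +
      (coeff j Z * coeff 1 Z - coeff 1 Z * coeff j Z) := by
    have h1 := congrArg (coeff (j + 1)) e4
    rw [coeff_succ_X_mul] at h1
    rw [h1, hU, mul_add, add_mul, ← mul_assoc, (commute_X Z).eq, mul_assoc X, mul_assoc X]
    simp only [map_sub, map_add, coeff_mul_C, coeff_C_mul, coeff_succ_X_mul]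
    noncomm_ring
  rw [← e5]
  exact hZ j a b

/-! ### The AKNS recursion and its values along a pair of functions. -/

namespace DiffPoly

theorem constantCoeff_D (p : DiffPoly) : MvPolynomial.constantCoeff (D p) = 0 := by
  induction p using MvPolynomial.induction_on with
  | C a => simp [D]
  | add a b ha hb => simp [ha, hb]
  | mul_X a v _ => simp [D, MvPolynomial.mkDerivation_X]

theorem constantCoeff_dInv (p : DiffPoly) : MvPolynomial.constantCoeff (dInv p) = 0 := by
  unfold dInv
  split_ifs with h
  · exact h.choose_spec.2
  · simp

theorem dInv_eq_of_D_eq {p s : DiffPoly} (h : D s = p) (h0 : MvPolynomial.constantCoeff s = 0) :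
    dInv p = s := by
  have hex : ∃ s : DiffPoly, D s = p ∧ MvPolynomial.constantCoeff s = 0 := ⟨s, h, h0⟩
  have hd : dInv p = hex.choose := dif_pos hex
  have := D_injective (dInv p - s) (by rw [map_sub, h, hd, hex.choose_spec.1, sub_self])
    (by rw [map_sub, constantCoeff_dInv, h0, sub_self])
  exact sub_eq_zero.1 this

/-- The antiderivative `∂ₓ⁻¹ (r K_{1,n} + q K_{2,n})` in the recursion. -/
noncomputable def aknsInt (n : ℕ) : DiffPoly := dInv (r * (akns n).1 + q * (akns n).2)

theorem akns_succ_fst (n : ℕ) :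
    (akns (n + 1)).1 = -D (akns n).1 + 2 * q * aknsInt n := by
  simp only [akns, Function.iterate_succ_apply', recOp, aknsInt]

theorem akns_succ_snd (n : ℕ) :
    (akns (n + 1)).2 = D (akns n).2 - 2 * r * aknsInt n := by
  simp only [akns, Function.iterate_succ_apply', recOp, aknsInt]

theorem constantCoeff_akns_fst (n : ℕ) : MvPolynomial.constantCoeff (akns n).1 = 0 := by
  cases n with
  | zero => simp [akns, q]
  | succ n => rw [akns_succ_fst]; simp [constantCoeff_D, q]

theorem aknsInt_zero : aknsInt 0 = 0 :=
  dInv_eq_of_D_eq (by simp [akns, mul_comm]) (by simp)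

/-- The quadratic recursion for the antiderivatives. -/
theorem aknsInt_succ (n : ℕ) : aknsInt (n + 1) = ∑ i ∈ Finset.range (n + 1),
    (aknsInt i * aknsInt (n - i) - (akns i).1 * (akns (n - i)).2) := by
  set u : ℕ → DiffPoly := fun n => (akns n).1 with hu
  set v : ℕ → DiffPoly := fun n => (akns n).2 with hv
  have us : ∀ n, D (u n) = 2 * q * aknsInt n - u (n + 1) := fun n => by
    simp only [hu, akns_succ_fst]; ring
  have vs : ∀ n, D (v n) = v (n + 1) + 2 * r * aknsInt n := fun n => by
    simp only [hv, akns_succ_snd]; ring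
  have ih : ∀ i, D (aknsInt i) = r * u i + q * v i := fun i => D_dInv_akns i
  refine dInv_eq_of_D_eq ?_ ?_
  · have tel : ∑ i ∈ Finset.range (n + 1),
        (u i * v (n + 1 - i) - u (i + 1) * v (n + 1 - (i + 1))) =
        u 0 * v (n + 1) - u (n + 1) * v 0 := by
      rw [Finset.sum_range_sub' (fun i => u i * v (n + 1 - i))]; simp
    have e : ∀ i ∈ Finset.range (n + 1), D (aknsInt i * aknsInt (n - i) - u i * v (n - i)) =
        (aknsInt i * (r * u (n - i) - q * v (n - i)) - aknsInt (n - i) * (r * u i - q * v i))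
        - (u i * v (n + 1 - i) - u (i + 1) * v (n + 1 - (i + 1))) := fun i hi => by
      have hi' : i ≤ n := by simpa [Nat.lt_succ_iff] using hi
      rw [map_sub, Derivation.leibniz, Derivation.leibniz, ih, ih, us, vs,
        show n + 1 - (i + 1) = n - i by omega, show n + 1 - i = (n - i) + 1 by omega]
      simp only [smul_eq_mul]
      ring
    have hrefl : ∑ i ∈ Finset.range (n + 1), aknsInt (n - i) * (r * u i - q * v i) =
        ∑ i ∈ Finset.range (n + 1), aknsInt i * (r * u (n - i) - q * v (n - i)) := by
      rw [← Finset.sum_range_reflect]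
      refine Finset.sum_congr rfl fun i hi => ?_
      have hi' : i ≤ n := by simpa [Nat.lt_succ_iff] using hi
      rw [show n + 1 - 1 - i = n - i by omega, show n - (n - i) = i by omega]
    rw [map_sum, Finset.sum_congr rfl e, Finset.sum_sub_distrib, Finset.sum_sub_distrib, hrefl,
      tel, sub_self]
    have h0 : u 0 = -q := rfl
    have h1 : v 0 = r := rfl
    rw [h0, h1]
    ring
  · rw [map_sum]
    refine Finset.sum_eq_zero fun i _ => ?_
    simp [constantCoeff_akns_fst, aknsInt, constantCoeff_dInv]

/-- The derivatives at `y` of the pair `(f, g)`. -/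
noncomputable def jet (f g : ℝ → ℂ) (y : ℝ) : Fin 2 × ℕ → ℂ :=
  fun v => iteratedDeriv v.2 (fun z => if v.1 = 0 then f z else g z) y

theorem contDiffAt_iteratedDeriv {f : ℝ → ℂ} {y : ℝ}
    (hf : ContDiffAt ℝ ((⊤ : ℕ∞) : WithTop ℕ∞) f y) (k : ℕ) :
    ContDiffAt ℝ ((⊤ : ℕ∞) : WithTop ℕ∞) (iteratedDeriv k f) y := by
  induction k with
  | zero => simpa using hf
  | succ k ih =>
    rw [iteratedDeriv_succ]
    exact (ih.fderiv_right (m := ((⊤ : ℕ∞) : WithTop ℕ∞)) le_rfl).clm_apply contDiffAt_const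

theorem hasDerivAt_iteratedDeriv {f : ℝ → ℂ} {y : ℝ}
    (hf : ContDiffAt ℝ ((⊤ : ℕ∞) : WithTop ℕ∞) f y) (k : ℕ) :
    HasDerivAt (iteratedDeriv k f) (iteratedDeriv (k + 1) f y) y := by
  rw [iteratedDeriv_succ]
  exact ((contDiffAt_iteratedDeriv hf k).differentiableAt (by simp)).hasDerivAt

/-- By Leibniz on both sides it suffices to treat the variables. This lets identities between values
on an open set be differentiated in `x`. -/
theorem hasDerivAt_eval_jet {f g : ℝ → ℂ} {y : ℝ}
    (hf : ContDiffAt ℝ ((⊤ : ℕ∞) : WithTop ℕ∞) f y)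
    (hg : ContDiffAt ℝ ((⊤ : ℕ∞) : WithTop ℕ∞) g y) (p : DiffPoly) :
    HasDerivAt (fun z => MvPolynomial.eval (jet f g z) p)
      (MvPolynomial.eval (jet f g y) (D p)) y := by
  induction p using MvPolynomial.induction_on with
  | C a => simpa [D] using hasDerivAt_const y a
  | add a b ha hb => simpa using ha.fun_add hb
  | mul_X p v hp =>
    have hX : HasDerivAt (fun z => jet f g z v) (jet f g y (v.1, v.2 + 1)) y := by
      unfold jet
      by_cases h : v.1 = 0 <;> simp only [h, if_true, if_false]
      · exact hasDerivAt_iteratedDeriv hf v.2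
      · exact hasDerivAt_iteratedDeriv hg v.2
    have hD : D (MvPolynomial.X v) = MvPolynomial.X (v.1, v.2 + 1) :=
      MvPolynomial.mkDerivation_X _ _ _
    have := hp.mul hX
    simp only [Derivation.leibniz, hD, map_mul, MvPolynomial.eval_X, map_add, smul_eq_mul]
    refine this.congr_deriv ?_
    ring

end DiffPoly

/-- Along a solution `W` of the first flow, the coefficients of `W⁻¹ (σ₃ / 2) W` are the values of
the differential polynomials of the AKNS hierarchy. -/
theorem coeff_dressedSigma_eq_akns {W : ℝ → PowerSeries (Matrix (Fin 2) (Fin 2) ℂ)} {O : Set ℝ}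
    (hO : IsOpen O) (hW : ∀ y, constantCoeff (W y) = 1)
    (hflow : ∀ y ∈ O, ∃ W', HasCoeffDerivAt W W' y ∧
      X * W' = -(W y * (dressedSigma (W y) - C halfSigma - X * C (coeff 1 (dressedSigma (W y))))))
    {f g : ℝ → ℂ} (hf : ∀ y ∈ O, ContDiffAt ℝ ((⊤ : ℕ∞) : WithTop ℕ∞) f y)
    (hg : ∀ y ∈ O, ContDiffAt ℝ ((⊤ : ℕ∞) : WithTop ℕ∞) g y)
    (hfW : ∀ y ∈ O, f y = -coeff 1 (W y) 0 1) (hgW : ∀ y ∈ O, g y = coeff 1 (W y) 1 0) (j : ℕ) :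
    ∀ y ∈ O,
      MvPolynomial.eval (DiffPoly.jet f g y) (DiffPoly.akns j).1 =
        coeff (j + 1) (dressedSigma (W y)) 0 1 ∧
      MvPolynomial.eval (DiffPoly.jet f g y) (DiffPoly.akns j).2 =
        -coeff (j + 1) (dressedSigma (W y)) 1 0 ∧
      MvPolynomial.eval (DiffPoly.jet f g y) (DiffPoly.aknsInt j) =
        -coeff (j + 1) (dressedSigma (W y)) 0 0 := by
  have hq : ∀ y, MvPolynomial.eval (DiffPoly.jet f g y) DiffPoly.q = f y := fun y => by
    simp [DiffPoly.q, DiffPoly.jet]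
  have hr : ∀ y, MvPolynomial.eval (DiffPoly.jet f g y) DiffPoly.r = g y := fun y => by
    simp [DiffPoly.r, DiffPoly.jet]
  induction j using Nat.strong_induction_on with
  | _ j ih =>
    cases j with
    | zero =>
      intro y hy
      rw [DiffPoly.aknsInt_zero]
      simp [DiffPoly.akns, hq, hr, hfW y hy, hgW y hy, coeff_one_dressedSigma_diag (hW y),
        coeff_one_dressedSigma_zero_one (hW y), coeff_one_dressedSigma_one_zero (hW y)]
    | succ j =>
      intro y hy
      have hev := hO.mem_nhds hy
      obtain ⟨W', hW', hX⟩ := hflow y hy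
      have htr := coeff_dressedSigma_trace (hW y)
      have hd := hW'.dressedSigma hW hX (j + 1)
      obtain ⟨i1, i2, i3⟩ := ih j (by omega) y hy
      -- The induction hypothesis holds on all of the open set `O`, so it may be differentiated;
      -- comparison with the Lax equation gives the next off-diagonal coefficients.
      have d1 := (DiffPoly.hasDerivAt_eval_jet (hf y hy) (hg y hy) (DiffPoly.akns j).1).unique
        ((hd 0 1).congr_of_eventuallyEq (Filter.eventually_of_mem hev fun z hz =>
          (ih j (by omega) z hz).1))
      have d2 := (DiffPoly.hasDerivAt_eval_jet (hf y hy) (hg y hy) (DiffPoly.akns j).2).unique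
        ((hd 1 0).neg.congr_of_eventuallyEq (Filter.eventually_of_mem hev fun z hz =>
          (ih j (by omega) z hz).2.1))
      have e1 := coeff_one_dressedSigma_zero_one (hW y)
      have e2 := coeff_one_dressedSigma_one_zero (hW y)
      simp [halfSigma, Matrix.mul_apply, htr, coeff_one_dressedSigma_diag (hW y), e1, e2,
        ← hgW y hy] at d1 d2
      refine ⟨?_, ?_, ?_⟩
      · rw [DiffPoly.akns_succ_fst]
        simp only [map_add, map_neg, map_mul, map_ofNat, hq, i3, d1]
        have := hfW y hy
        linear_combination (-2 * coeff (j + 1) (dressedSigma (W y)) 0 0) * this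
      · rw [DiffPoly.akns_succ_snd]
        simp only [map_sub, map_mul, map_ofNat, hr, i3, d2]
        ring
      -- The diagonal entry is not integrated but matched term by term through the two quadratic
      -- identities, which involve all earlier indices; hence the strong induction.
      · rw [DiffPoly.aknsInt_succ, coeff_dressedSigma_det (hW y), map_sum]
        refine Finset.sum_congr rfl fun i hi => ?_
        have hi' := Finset.mem_range.1 hi
        obtain ⟨a1, a2, a3⟩ := ih i (by omega) y hy
        obtain ⟨b1, b2, b3⟩ := ih (j - i) (by omega) y hy
        rw [map_sub, map_mul, map_mul, a1, a3, b2, b3]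
        ring

/-! ### Krylov sums and the Sato–Wilson equation. -/

section

variable {N : ℕ} {A : Matrix (Fin N) (Fin N) ℂ} {Y : Matrix (Fin N) (Fin 2) ℂ}
  {F G : PowerSeries (Matrix (Fin 2) (Fin 2) ℂ)}

/-- The matrix `∑_{j ≤ M} A^{M-j} Y F_j`: the action on the columns of `Y` of the polynomial part
of `X^{-M} F`, where `X⁻¹` acts as `A`. -/
noncomputable def krylovSum (A : Matrix (Fin N) (Fin N) ℂ) (Y : Matrix (Fin N) (Fin 2) ℂ) (M : ℕ)
    (F : PowerSeries (Matrix (Fin 2) (Fin 2) ℂ)) : Matrix (Fin N) (Fin 2) ℂ :=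
  ∑ j ∈ Finset.range (M + 1), A ^ (M - j) * Y * coeff j F

theorem krylovSum_add (M : ℕ) :
    krylovSum A Y M (F + G) = krylovSum A Y M F + krylovSum A Y M G := by
  simp [krylovSum, Matrix.mul_add, Finset.sum_add_distrib]

theorem krylovSum_X_mul (M : ℕ) : krylovSum A Y (M + 1) (X * F) = krylovSum A Y M F := by
  rw [krylovSum, Finset.sum_range_succ']
  simp [krylovSum, coeff_succ_X_mul]

theorem krylovSum_one_add_X_mul (M : ℕ) :
    krylovSum A Y (M + 1) (1 + X * F) = A ^ (M + 1) * Y + krylovSum A Y M F := by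
  rw [krylovSum_add, krylovSum_X_mul, krylovSum, Finset.sum_range_succ']
  simp [coeff_one]

/-- Powers of `A` act on the left and coefficients on the right, so the product may be grouped by
the coefficients of `G`; the index `l` lowers the truncation for `F` to `M - l`. -/
theorem krylovSum_mul (M : ℕ) : krylovSum A Y M (F * G) =
    ∑ l ∈ Finset.range (M + 1), krylovSum A Y (M - l) F * coeff l G := by
  have h := Finset.sum_range_diag_flip (M + 1)
    fun l i => A ^ (M - l - i) * Y * coeff i F * coeff l G
  have hr : ∀ l ∈ Finset.range (M + 1), krylovSum A Y (M - l) F * coeff l G =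
      ∑ i ∈ Finset.range (M + 1 - l), A ^ (M - l - i) * Y * coeff i F * coeff l G := fun l hl => by
    rw [krylovSum, Matrix.sum_mul,
      show M - l + 1 = M + 1 - l by have := Finset.mem_range.1 hl; omega]
  rw [Finset.sum_congr rfl hr, ← h, krylovSum]
  refine Finset.sum_congr rfl fun j _ => ?_
  rw [coeff_mul, Finset.Nat.sum_antidiagonal_eq_sum_range_succ
    (fun i l => coeff i F * coeff l G), ← Finset.sum_range_reflect, Matrix.mul_sum]
  refine Finset.sum_congr rfl fun l hl => ?_
  have hl' := Finset.mem_range.1 hl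
  rw [show j.succ - 1 - l = j - l by omega, show j - (j - l) = l by omega,
    show M - l - (j - l) = M - j by omega, Matrix.mul_assoc _ _ (coeff l G)]

/-- For a polynomial of degree at most `d`, a higher truncation loses nothing and only multiplies by
a power of `A`. In particular an annihilator stays one. -/
theorem krylovSum_add_of_coeff_eq_zero (d k : ℕ) (hF : ∀ j, d < j → coeff j F = 0) :
    krylovSum A Y (d + k) F = A ^ k * krylovSum A Y d F := by
  rw [krylovSum, krylovSum, show d + k + 1 = d + 1 + k by omega, Finset.sum_range_add,
    Finset.sum_eq_zero (s := Finset.range k) fun j _ => by rw [hF _ (by omega), Matrix.mul_zero],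
    add_zero, Matrix.mul_sum]
  refine Finset.sum_congr rfl fun j hj => ?_
  rw [show d + k - j = k + (d - j) by have := Finset.mem_range.1 hj; omega, pow_add]
  simp only [Matrix.mul_assoc]

/-- The flow `Y' = A^k Y σ₃ / 2` of a frame with a monic annihilator `W` induces the `k`-th AKNS
flow on `W`. -/
theorem dressing_flow {n k : ℕ} {W W' : PowerSeries (Matrix (Fin 2) (Fin 2) ℂ)}
    (hY : ∀ F, krylovSum A Y n F = 0 → ∀ j ≤ n, coeff j F = 0)
    (hW : constantCoeff W = 1) (hdeg : ∀ j, n + 1 < j → coeff j W = 0)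
    (hW0 : constantCoeff W' = 0) (hdeg' : ∀ j, n + 1 < j → coeff j W' = 0)
    (hann : krylovSum A Y (n + 1) W = 0)
    (hder : krylovSum A (A ^ k * Y * halfSigma) (n + 1) W + krylovSum A Y (n + 1) W' = 0) :
    W' = -(X * (W * mk fun l => coeff (l + (k + 1)) (dressedSigma W))) := by
  set R : PowerSeries (Matrix (Fin 2) (Fin 2) ℂ) :=
    mk fun l => coeff (l + (k + 1)) (dressedSigma W) with hR
  have hWZ := mul_dressedSigma hW
  have e1 : krylovSum A (A ^ k * Y * halfSigma) (n + 1) W =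
      krylovSum A Y (n + 1 + k) (C halfSigma * W) := by
    rw [krylovSum_add_of_coeff_eq_zero (n + 1) k fun j hj => by rw [coeff_C_mul, hdeg j hj, mul_zero],
      krylovSum, krylovSum, Matrix.mul_sum]
    refine Finset.sum_congr rfl fun j _ => ?_
    rw [coeff_C_mul]
    simp only [← Matrix.mul_assoc, ← pow_add, add_comm k]
  -- Replace `(σ₃/2) W` by `W Z`. The coefficients `Z_l` with `l ≤ k` are multiplied by `A^{k-l}`
  -- times the vanishing sum for `W`, so only the tail `R` of `Z` survives.
  have e2 : krylovSum A Y (n + 1 + k) (C halfSigma * W) = krylovSum A Y n (W * R) := by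
    rw [← hWZ, krylovSum_mul, krylovSum_mul, show n + 1 + k + 1 = k + 1 + (n + 1) by omega,
      Finset.sum_range_add, Finset.sum_eq_zero (s := Finset.range (k + 1)), zero_add]
    · refine Finset.sum_congr rfl fun l _ => ?_
      rw [show n + 1 + k - (k + 1 + l) = n - l by omega, hR, coeff_mk, add_comm l]
    · intro l hl
      rw [show n + 1 + k - l = n + 1 + (k - l) by have := Finset.mem_range.1 hl; omega,
        krylovSum_add_of_coeff_eq_zero _ _ hdeg, hann, Matrix.mul_zero, Matrix.zero_mul]
  obtain ⟨V, hV⟩ : ∃ V, W' = X * V := X_dvd_iff.2 hW0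
  have hVc : ∀ j, coeff j V = coeff (j + 1) W' := fun j => by rw [hV, coeff_succ_X_mul]
  have h0 : krylovSum A Y n (W * R + V) = 0 := by
    rw [krylovSum_add, ← e2, ← e1, ← krylovSum_X_mul n (F := V), ← hV, hder]
  suffices h : W * R + V = 0 by
    rw [hV, ← mul_neg, eq_neg_of_add_eq_zero_right h]
  ext1 j
  rcases le_or_gt j n with hj | hj
  · simpa using hY _ h0 j hj
  -- Above degree `n` independence says nothing; there the degree bound is used. The right side of
  -- `W Z = (σ₃/2) W` vanishes in degree `j + k + 1`, and `Z_l` with `l ≤ k` meets only vanishing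
  -- coefficients of `W`.
  · have h1 := congrArg (coeff (j + (k + 1))) hWZ
    rw [coeff_C_mul, hdeg _ (by omega), mul_zero, coeff_mul,
      Finset.Nat.sum_antidiagonal_eq_sum_range_succ
        (fun i l => coeff i W * coeff l (dressedSigma W)),
      show (j + (k + 1)).succ = j + 1 + (k + 1) by omega, Finset.sum_range_add,
      Finset.sum_eq_zero (s := Finset.range (k + 1)) fun l _ => by
        rw [hdeg _ (by omega), zero_mul], add_zero] at h1
    rw [map_add, hVc, hdeg' _ (by omega), add_zero, map_zero, coeff_mul,
      Finset.Nat.sum_antidiagonal_eq_sum_range_succ (fun i l => coeff i W * coeff l R), ← h1]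
    refine Finset.sum_congr rfl fun i hi => ?_
    rw [hR, coeff_mk, show j - i + (k + 1) = j + (k + 1) - i by
      have := Finset.mem_range.1 hi; omega]

end

/-! ### The monic annihilator by Cramer's rule, and its flows. -/

section

variable {m : ℕ}

/-- The matrix with columns `φ, Aφ, …, A^{m-1}φ, ψ, Aψ, …, A^{m-1}ψ`, where `φ, ψ` are the columns
of `Y`. -/
noncomputable def krylovMatrix (A : Matrix (Fin (m + m)) (Fin (m + m)) ℂ)
    (Y : Matrix (Fin (m + m)) (Fin 2) ℂ) : Matrix (Fin (m + m)) (Fin (m + m)) ℂ :=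
  Matrix.of fun i => Fin.append (fun k : Fin m => (A ^ (k : ℕ) * Y) i 0)
    (fun k : Fin m => (A ^ (k : ℕ) * Y) i 1)

/-- The coefficients, by Cramer's rule, of the column `e` of `A^m Y` in terms of the columns of
`krylovMatrix A Y`. -/
noncomputable def krylovCoeff (A : Matrix (Fin (m + m)) (Fin (m + m)) ℂ)
    (Y : Matrix (Fin (m + m)) (Fin 2) ℂ) (e : Fin 2) (j : Fin (m + m)) : ℂ :=
  ((krylovMatrix A Y).updateCol j fun i => (A ^ m * Y) i e).det / (krylovMatrix A Y).det

/-- The monic annihilator of `Y`, as a power series in the inverse spectral parameter. -/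
noncomputable def dressing (A : Matrix (Fin (m + m)) (Fin (m + m)) ℂ)
    (Y : Matrix (Fin (m + m)) (Fin 2) ℂ) : PowerSeries (Matrix (Fin 2) (Fin 2) ℂ) :=
  1 + X * mk fun j => if h : j < m then
    -Matrix.of ![fun e => krylovCoeff A Y e (Fin.castAdd m (Fin.rev ⟨j, h⟩)),
      fun e => krylovCoeff A Y e (Fin.natAdd m (Fin.rev ⟨j, h⟩))] else 0

theorem constantCoeff_dressing (A : Matrix (Fin (m + m)) (Fin (m + m)) ℂ)
    (Y : Matrix (Fin (m + m)) (Fin 2) ℂ) : constantCoeff (dressing A Y) = 1 := by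
  simp [dressing]

theorem coeff_succ_dressing (A : Matrix (Fin (m + m)) (Fin (m + m)) ℂ)
    (Y : Matrix (Fin (m + m)) (Fin 2) ℂ) (j : ℕ) :
    coeff (j + 1) (dressing A Y) = if h : j < m then
    -Matrix.of ![fun e => krylovCoeff A Y e (Fin.castAdd m (Fin.rev ⟨j, h⟩)),
      fun e => krylovCoeff A Y e (Fin.natAdd m (Fin.rev ⟨j, h⟩))] else 0 := by
  rw [dressing, map_add, coeff_succ_X_mul, coeff_mk, coeff_one, if_neg (by omega), zero_add]

theorem krylovMatrix_mulVec (A : Matrix (Fin (m + m)) (Fin (m + m)) ℂ)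
    (Y : Matrix (Fin (m + m)) (Fin 2) ℂ) (u : Fin (m + m) → ℂ) (i : Fin (m + m)) :
    (krylovMatrix A Y).mulVec u i = ∑ k : Fin m, ((A ^ (k : ℕ) * Y) i 0 * u (Fin.castAdd m k) +
      (A ^ (k : ℕ) * Y) i 1 * u (Fin.natAdd m k)) := by
  simp [-Fin.natAdd_eq_addNat, krylovMatrix, Matrix.mulVec, dotProduct, Fin.sum_univ_add, Finset.sum_add_distrib]

/-- The coefficient of `X^j` goes with `A^{n-j} Y`, while the columns of the Krylov matrix are
listed by increasing power of `A`; hence the reversal of indices. -/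
theorem krylovSum_apply {n : ℕ} (A : Matrix (Fin (n + 1 + (n + 1))) (Fin (n + 1 + (n + 1))) ℂ)
    (Y : Matrix (Fin (n + 1 + (n + 1))) (Fin 2) ℂ) (F : PowerSeries (Matrix (Fin 2) (Fin 2) ℂ))
    (i : Fin (n + 1 + (n + 1))) (e : Fin 2) :
    krylovSum A Y n F i e = (krylovMatrix A Y).mulVec
      (Fin.append (fun k : Fin (n + 1) => coeff (k.rev : ℕ) F 0 e)
        (fun k : Fin (n + 1) => coeff (k.rev : ℕ) F 1 e)) i := by
  rw [krylovMatrix_mulVec, krylovSum, Finset.sum_range, Matrix.sum_apply,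
    ← Equiv.sum_comp Fin.revPerm]
  refine Finset.sum_congr rfl fun k _ => ?_
  have : n - ((Fin.rev k : Fin (n + 1)) : ℕ) = k := by rw [Fin.val_rev]; omega
  simp only [Fin.revPerm_apply, this, Fin.append_left, Fin.append_right,
    Matrix.mul_apply (N := coeff _ F), Fin.sum_univ_two]

theorem mulVec_krylovCoeff {A : Matrix (Fin (m + m)) (Fin (m + m)) ℂ}
    {Y : Matrix (Fin (m + m)) (Fin 2) ℂ} (h : (krylovMatrix A Y).det ≠ 0) (e : Fin 2) :
    (krylovMatrix A Y).mulVec (krylovCoeff A Y e) = fun i => (A ^ m * Y) i e := by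
  have : krylovCoeff A Y e = (krylovMatrix A Y).det⁻¹ •
      (krylovMatrix A Y).cramer fun i => (A ^ m * Y) i e := by
    ext j; simp [krylovCoeff, Matrix.cramer_apply, div_eq_inv_mul]
  rw [this, Matrix.mulVec_smul, Matrix.mulVec_cramer, smul_smul, inv_mul_cancel₀ h, one_smul]

theorem eq_krylovCoeff {A : Matrix (Fin (m + m)) (Fin (m + m)) ℂ}
    {Y : Matrix (Fin (m + m)) (Fin 2) ℂ} (h : (krylovMatrix A Y).det ≠ 0) (e : Fin 2)
    {u : Fin (m + m) → ℂ} (hu : (krylovMatrix A Y).mulVec u = fun i => (A ^ m * Y) i e) :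
    u = krylovCoeff A Y e := by
  refine sub_eq_zero.1 (Matrix.eq_zero_of_mulVec_eq_zero h ?_)
  rw [Matrix.mulVec_sub, hu, mulVec_krylovCoeff h, sub_self]

variable {n : ℕ} {A : Matrix (Fin (n + 1 + (n + 1))) (Fin (n + 1 + (n + 1))) ℂ}

/-- Linear independence of the Krylov columns, in the form of the uniqueness hypothesis of
`dressing_flow`. -/
theorem krylovSum_injective {Y : Matrix (Fin (n + 1 + (n + 1))) (Fin 2) ℂ}
    (h : (krylovMatrix A Y).det ≠ 0) (F : PowerSeries (Matrix (Fin 2) (Fin 2) ℂ))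
    (hF : krylovSum A Y n F = 0) (j : ℕ) (hj : j ≤ n) : coeff j F = 0 := by
  have key : ∀ e, Fin.append (fun k : Fin (n + 1) => coeff (k.rev : ℕ) F 0 e)
        (fun k : Fin (n + 1) => coeff (k.rev : ℕ) F 1 e) = 0 := fun e => by
    refine Matrix.eq_zero_of_mulVec_eq_zero h ?_
    ext i
    rw [← krylovSum_apply, hF]; rfl
  ext a e
  let k : Fin (n + 1) := Fin.rev ⟨j, by omega⟩
  have hk : (k.rev : ℕ) = j := by rw [Fin.rev_rev]
  have h0 := congrFun (key e) (Fin.castAdd _ k)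
  have h1 := congrFun (key e) (Fin.natAdd _ k)
  rw [Fin.append_left, hk] at h0
  rw [Fin.append_right, hk] at h1
  fin_cases a
  · exact h0
  · exact h1

theorem krylovSum_dressing {Y : Matrix (Fin (n + 1 + (n + 1))) (Fin 2) ℂ}
    (h : (krylovMatrix A Y).det ≠ 0) : krylovSum A Y (n + 1) (dressing A Y) = 0 := by
  rw [dressing, krylovSum_one_add_X_mul]
  ext i e
  rw [Matrix.add_apply, krylovSum_apply, Matrix.zero_apply]
  have : (Fin.append (fun k : Fin (n + 1) => coeff (k.rev : ℕ) (mk fun j => if h : j < n + 1 then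
        -Matrix.of ![fun e => krylovCoeff A Y e (Fin.castAdd (n + 1) (Fin.rev ⟨j, h⟩)),
      fun e => krylovCoeff A Y e (Fin.natAdd (n + 1) (Fin.rev ⟨j, h⟩))] else 0) 0 e)
        (fun k : Fin (n + 1) => coeff (k.rev : ℕ) (mk fun j => if h : j < n + 1 then
        -Matrix.of ![fun e => krylovCoeff A Y e (Fin.castAdd (n + 1) (Fin.rev ⟨j, h⟩)),
      fun e => krylovCoeff A Y e (Fin.natAdd (n + 1) (Fin.rev ⟨j, h⟩))] else 0) 1 e)) =
      -krylovCoeff A Y e := by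
    ext j
    have hr : ∀ k : Fin (n + 1), Fin.rev ⟨(k.rev : ℕ), k.rev.isLt⟩ = k := fun k => Fin.rev_rev k
    induction j using Fin.addCases with
    | left k =>
      rw [Fin.append_left, coeff_mk, dif_pos k.rev.isLt, hr]; rfl
    | right k =>
      rw [Fin.append_right, coeff_mk, dif_pos k.rev.isLt, hr]; rfl
  rw [this, Matrix.mulVec_neg, mulVec_krylovCoeff h]
  simp

theorem coeff_one_dressing (Y : Matrix (Fin (n + 1 + (n + 1))) (Fin 2) ℂ) (e : Fin 2) :
    coeff 1 (dressing A Y) 0 e = -krylovCoeff A Y e (Fin.castAdd _ (Fin.last n)) ∧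
    coeff 1 (dressing A Y) 1 e = -krylovCoeff A Y e (Fin.natAdd _ (Fin.last n)) := by
  have h : coeff 1 (dressing A Y) = _ := (coeff_succ_dressing A Y 0).trans (dif_pos (by omega))
  rw [h]
  exact ⟨rfl, rfl⟩

theorem differentiableAt_det {ι : Type*} [Fintype ι] [DecidableEq ι] {M : ℝ → Matrix ι ι ℂ} {s : ℝ}
    (h : ∀ i j, DifferentiableAt ℝ (fun y => M y i j) s) :
    DifferentiableAt ℝ (fun y => (M y).det) s := by
  simp only [Matrix.det_apply']
  exact DifferentiableAt.fun_sum fun σ _ => (differentiableAt_const _).mul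
    (DifferentiableAt.fun_finsetProd fun i _ => h _ _)

theorem contDiffAt_det {ι : Type*} [Fintype ι] [DecidableEq ι] {M : ℝ → Matrix ι ι ℂ} {s : ℝ}
    {k : WithTop ℕ∞} (h : ∀ i j, ContDiffAt ℝ k (fun y => M y i j) s) :
    ContDiffAt ℝ k (fun y => (M y).det) s := by
  simp only [Matrix.det_apply']
  exact ContDiffAt.sum fun σ _ => contDiffAt_const.mul (contDiffAt_prod fun i _ => h _ _)

theorem differentiableAt_krylovMatrix {A : Matrix (Fin (m + m)) (Fin (m + m)) ℂ}
    {Y : ℝ → Matrix (Fin (m + m)) (Fin 2) ℂ} {s : ℝ}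
    (h : ∀ i e, DifferentiableAt ℝ (fun y => Y y i e) s) (i j : Fin (m + m)) :
    DifferentiableAt ℝ (fun y => krylovMatrix A (Y y) i j) s := by
  induction j using Fin.addCases <;> simp only [krylovMatrix, Matrix.of_apply, Fin.append_left,
    Fin.append_right, Matrix.mul_apply] <;> fun_prop

theorem contDiffAt_krylovMatrix {A : Matrix (Fin (m + m)) (Fin (m + m)) ℂ}
    {Y : ℝ → Matrix (Fin (m + m)) (Fin 2) ℂ} {s : ℝ} {k : WithTop ℕ∞}
    (h : ∀ i e, ContDiffAt ℝ k (fun y => Y y i e) s) (i j : Fin (m + m)) :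
    ContDiffAt ℝ k (fun y => krylovMatrix A (Y y) i j) s := by
  induction j using Fin.addCases <;> simp only [krylovMatrix, Matrix.of_apply, Fin.append_left,
    Fin.append_right, Matrix.mul_apply] <;>
  exact ContDiffAt.sum fun l _ => contDiffAt_const.mul (h _ _)

theorem differentiableAt_krylovCoeff {A : Matrix (Fin (m + m)) (Fin (m + m)) ℂ}
    {Y : ℝ → Matrix (Fin (m + m)) (Fin 2) ℂ} {s : ℝ}
    (h : ∀ i e, DifferentiableAt ℝ (fun y => Y y i e) s) (hs : (krylovMatrix A (Y s)).det ≠ 0)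
    (e : Fin 2) (j : Fin (m + m)) :
    DifferentiableAt ℝ (fun y => krylovCoeff A (Y y) e j) s := by
  unfold krylovCoeff
  refine DifferentiableAt.div (differentiableAt_det fun i l => ?_)
    (differentiableAt_det (differentiableAt_krylovMatrix h)) hs
  by_cases hl : l = j
  · subst hl
    simp only [Matrix.updateCol_self, Matrix.mul_apply]
    fun_prop
  · simpa only [Matrix.updateCol_ne hl] using differentiableAt_krylovMatrix h i l

theorem contDiffAt_krylovCoeff {A : Matrix (Fin (m + m)) (Fin (m + m)) ℂ}
    {Y : ℝ → Matrix (Fin (m + m)) (Fin 2) ℂ} {s : ℝ} {k : WithTop ℕ∞}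
    (h : ∀ i e, ContDiffAt ℝ k (fun y => Y y i e) s) (hs : (krylovMatrix A (Y s)).det ≠ 0)
    (e : Fin 2) (j : Fin (m + m)) :
    ContDiffAt ℝ k (fun y => krylovCoeff A (Y y) e j) s := by
  simp only [krylovCoeff, div_eq_mul_inv]
  refine ContDiffAt.mul (contDiffAt_det fun i l => ?_)
    ((contDiffAt_det (contDiffAt_krylovMatrix h)).inv hs)
  by_cases hl : l = j
  · subst hl
    simp only [Matrix.updateCol_self, Matrix.mul_apply]
    exact ContDiffAt.sum fun l _ => contDiffAt_const.mul (h _ _)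
  · simpa only [Matrix.updateCol_ne hl] using contDiffAt_krylovMatrix h i l

/-- The `k`-th AKNS flow of the monic annihilator. -/
theorem hasCoeffDerivAt_dressing {Y : ℝ → Matrix (Fin (n + 1 + (n + 1))) (Fin 2) ℂ} {s : ℝ} {k : ℕ}
    (hY : ∀ i e, HasDerivAt (fun y => Y y i e) ((A ^ k * Y s * halfSigma) i e) s)
    (hs : (krylovMatrix A (Y s)).det ≠ 0) :
    HasCoeffDerivAt (fun y => dressing A (Y y))
      (-(X * (dressing A (Y s) * mk fun l => coeff (l + (k + 1)) (dressedSigma (dressing A (Y s))))))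
      s := by
  have hdeg : ∀ y j, n + 1 < j → coeff j (dressing A (Y y)) = 0 := fun y j hj => by
    obtain ⟨j, rfl⟩ : ∃ i, j = i + 1 := ⟨j - 1, by omega⟩
    rw [coeff_succ_dressing, dif_neg (by omega)]
  have hdiff : ∀ j a b, DifferentiableAt ℝ (fun y => coeff j (dressing A (Y y)) a b) s := by
    intro j a b
    cases j with
    | zero => simp [constantCoeff_dressing]
    | succ j =>
      simp only [coeff_succ_dressing]
      split_ifs
      · have := fun i => differentiableAt_krylovCoeff (A := A)
          (fun i e => (hY i e).differentiableAt) hs b i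
        fin_cases a
        · exact (this (Fin.castAdd _ _)).fun_neg
        · exact (this (Fin.natAdd _ _)).fun_neg
      · simp
  -- Cramer's quotients are differentiable, so some derivative exists; `dressing_flow` then
  -- identifies it.
  obtain ⟨W', hW'⟩ : ∃ W', HasCoeffDerivAt (fun y => dressing A (Y y)) W' s := by
    refine ⟨mk fun j => Matrix.of fun a b => deriv (fun y => coeff j (dressing A (Y y)) a b) s,
      fun j a b => ?_⟩
    simpa using (hdiff j a b).hasDerivAt
  convert hW'
  symm
  refine dressing_flow (krylovSum_injective hs) (constantCoeff_dressing A _) (hdeg s) ?_ ?_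
    (krylovSum_dressing hs) ?_
  · ext a b
    have := hW' 0 a b
    simp only [coeff_zero_eq_constantCoeff, constantCoeff_dressing] at this
    exact this.unique (hasDerivAt_const _ _)
  · intro j hj
    ext a b
    have := hW' j a b
    simp only [hdeg _ j hj] at this
    exact this.unique (hasDerivAt_const _ _)
  -- The annihilation relation persists near `s`, so its derivative, computed by the product rule,
  -- is zero.
  · have hnear : ∀ᶠ y in nhds s, (krylovMatrix A (Y y)).det ≠ 0 :=
      (differentiableAt_det (differentiableAt_krylovMatrix
        fun i e => (hY i e).differentiableAt)).continuousAt.eventually_ne hs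
    ext i e
    have h1 : HasDerivAt (fun y => krylovSum A (Y y) (n + 1) (dressing A (Y y)) i e)
        ((krylovSum A (A ^ k * Y s * halfSigma) (n + 1) (dressing A (Y s)) +
          krylovSum A (Y s) (n + 1) W') i e) s := by
      simp only [krylovSum, Matrix.add_apply, Matrix.sum_apply, ← Finset.sum_add_distrib,
        Matrix.mul_apply (N := coeff _ _)]
      refine HasDerivAt.fun_sum fun j _ => HasDerivAt.fun_sum fun l _ =>
        HasDerivAt.mul ?_ (hW' j l e)
      simp only [Matrix.mul_apply (M := A ^ (n + 1 - j))]
      exact HasDerivAt.fun_sum fun p _ => (hY p l).const_mul _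
    refine h1.unique ((hasDerivAt_const s (0 : ℂ)).congr_of_eventuallyEq ?_)
    filter_upwards [hnear] with y hy
    rw [krylovSum_dressing hy]; rfl

end

/-! ### Derivatives of the exponentials `φ` and `ψ`. -/

section

open scoped Matrix.Norms.Operator

variable {N : ℕ}

theorem exp_mulVec_semiconj {T B D : Matrix (Fin N) (Fin N) ℂ} (h : SemiconjBy T B D)
    (C : Fin N → ℂ) : T.mulVec ((NormedSpace.exp B).mulVec C) =
      (NormedSpace.exp D).mulVec (T.mulVec C) := by
  rw [Matrix.mulVec_mulVec, Matrix.mulVec_mulVec]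
  exact congrArg (fun M : Matrix (Fin N) (Fin N) ℂ => M.mulVec C) h.exp_right

theorem hasDerivAt_exp_mulVec {B D : Matrix (Fin N) (Fin N) ℂ} (h : Commute B D) (C : Fin N → ℂ)
    (s : ℝ) (i : Fin N) :
    HasDerivAt (fun y : ℝ => (NormedSpace.exp (B + (y : ℂ) • D)).mulVec C i)
      (D.mulVec ((NormedSpace.exp (B + (s : ℂ) • D)).mulVec C) i) s := by
  have he : ∀ y : ℂ, NormedSpace.exp (B + y • D) =
      NormedSpace.exp (y • D) * NormedSpace.exp B := fun y => by
    rw [add_comm, Matrix.exp_add_of_commute _ _ (h.symm.smul_left y)]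
  let L : Matrix (Fin N) (Fin N) ℂ →ₗ[ℂ] ℂ :=
    { toFun := fun M => (M * NormedSpace.exp B).mulVec C i
      map_add' := fun P Q => by rw [Matrix.add_mul, Matrix.add_mulVec]; rfl
      map_smul' := fun c P => by rw [Matrix.smul_mul, Matrix.smul_mulVec]; rfl }
  have h1 := (L.toContinuousLinearMap.hasFDerivAt.comp_hasDerivAt (s : ℂ)
    (hasDerivAt_exp_smul_const' (𝕂 := ℂ) D (s : ℂ))).comp_ofReal
  simp only [he, Matrix.mulVec_mulVec, ← Matrix.mul_assoc]
  exact h1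

variable (A : Matrix (Fin N) (Fin N) ℂ) (C : Fin N → ℂ)

/-- The times carry even powers of `A`, so `A ↦ -A` changes the sign of the `x`-term only. This
reduces the differentiation of `ψ` to that of `φ`. -/
theorem psi_eq_phi_neg (x : ℝ) (t : ℕ → ℝ) : psi A C x t = phi (-A) C x (-t) := by
  have : (fun j => (((-t) j : ℝ) : ℂ) • (-A) ^ (2 * (j + 1))) =
      fun j => -((t j : ℂ) • A ^ (2 * (j + 1))) := by
    ext1 j
    rw [(even_two_mul _).neg_pow]
    simp
  rw [psi, phi, this, tsum_neg]
  simp [sub_eq_add_neg]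

theorem hasDerivAt_phi_space (x : ℝ) (t : ℕ → ℝ) (i : Fin N) :
    HasDerivAt (fun y => phi A C y t i) ((((1 / 2 : ℂ) • A).mulVec (phi A C x t)) i) x := by
  set S := ∑' j, (t j : ℂ) • A ^ (2 * (j + 1)) with hS
  -- This holds even for a divergent series, whose sum is then 0 by default; so derivatives in `x`
  -- need no condition on `t`.
  have hc : Commute ((1 / 2 : ℂ) • S) ((1 / 2 : ℂ) • A) :=
    ((Commute.tsum_left A fun j => ((Commute.refl A).pow_left _).smul_left _).smul_left
      _).smul_right _
  have he : ∀ y : ℝ, phi A C y t =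
      (NormedSpace.exp ((1 / 2 : ℂ) • S + (y : ℂ) • ((1 / 2 : ℂ) • A))).mulVec C := fun y => by
    rw [phi, add_comm, smul_comm]
  simp only [he]
  exact hasDerivAt_exp_mulVec hc C x i

variable {A}

theorem TimesConverge.hasSum_update {t : ℕ → ℝ} (h : TimesConverge A t) (j : ℕ) (s : ℝ) :
    HasSum (fun k => ((Function.update t j s k : ℝ) : ℂ) • A ^ (2 * (k + 1)))
      (∑' k, (t k : ℂ) • A ^ (2 * (k + 1)) + ((s : ℂ) - t j) • A ^ (2 * (j + 1))) := by
  have h1 := h.hasSum.add (hasSum_ite_eq j (((s : ℂ) - t j) • A ^ (2 * (j + 1))))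
  refine h1.congr_fun fun k => ?_
  by_cases hk : k = j
  · subst hk
    simp only [Function.update_self, if_true]
    module
  · simp [hk]

theorem hasDerivAt_phi_time (x : ℝ) {t : ℕ → ℝ} (h : TimesConverge A t) (j : ℕ) (i : Fin N) :
    HasDerivAt (fun s => phi A C x (Function.update t j s) i)
      ((((1 / 2 : ℂ) • A ^ (2 * (j + 1))).mulVec (phi A C x t)) i) (t j) := by
  set S := ∑' k, (t k : ℂ) • A ^ (2 * (k + 1)) with hS
  set D := (1 / 2 : ℂ) • A ^ (2 * (j + 1)) with hD
  -- The exponent without its `t j` term, so that the dependence on this time is affine.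
  set B := (1 / 2 : ℂ) • ((x : ℂ) • A) + (1 / 2 : ℂ) • S - (t j : ℂ) • D with hB
  have hcS : Commute S D :=
    (Commute.tsum_left (A ^ (2 * (j + 1))) fun k =>
      ((Commute.refl A).pow_pow _ _).smul_left _).smul_right _
  have hcA : Commute A D := ((Commute.refl A).pow_right _).smul_right _
  have hc : Commute B D := (((hcA.smul_left _).smul_left _).add_left (hcS.smul_left _)).sub_left
    ((Commute.refl D).smul_left _)
  have he : ∀ s : ℝ, phi A C x (Function.update t j s) =
      (NormedSpace.exp (B + (s : ℂ) • D)).mulVec C := fun s => by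
    rw [phi, (h.hasSum_update j s).tsum_eq, hB, hD]
    congr 2
    module
  have h1 := he (t j)
  rw [Function.update_eq_self] at h1
  rw [h1]
  simp only [he]
  exact hasDerivAt_exp_mulVec hc C (t j) i

theorem TimesConverge.neg {t : ℕ → ℝ} (h : TimesConverge A t) : TimesConverge A (-t) :=
  (Summable.neg h).congr fun j => by simp

theorem TimesConverge.neg_left {t : ℕ → ℝ} (h : TimesConverge A t) : TimesConverge (-A) t :=
  Summable.congr h fun j => by rw [(even_two_mul _).neg_pow]

theorem hasDerivAt_psi_space (x : ℝ) (t : ℕ → ℝ) (i : Fin N) :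
    HasDerivAt (fun y => psi A C y t i) ((((-1 / 2 : ℂ) • A).mulVec (psi A C x t)) i) x := by
  simp only [psi_eq_phi_neg]
  refine (hasDerivAt_phi_space (-A) C x (-t) i).congr_deriv ?_
  rw [show (1 / 2 : ℂ) • -A = (-1 / 2 : ℂ) • A by module]

theorem hasDerivAt_psi_time (x : ℝ) {t : ℕ → ℝ} (h : TimesConverge A t) (j : ℕ) (i : Fin N) :
    HasDerivAt (fun s => psi A C x (Function.update t j s) i)
      ((((-1 / 2 : ℂ) • A ^ (2 * (j + 1))).mulVec (psi A C x t)) i) (t j) := by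
  have h1 := hasDerivAt_phi_time C x h.neg_left.neg j i
  have h2 := HasDerivAt.scomp (t j) (h := fun s : ℝ => -s)
    (g₁ := fun s => phi (-A) C x (Function.update (-t) j s) i) h1 (hasDerivAt_neg (t j))
  have h3 : ∀ s, -Function.update t j s = Function.update (-t) j (-s) := fun s => by
    ext k
    by_cases hk : k = j <;> simp [hk]
  simp only [psi_eq_phi_neg, h3]
  refine h2.congr_deriv ?_
  rw [(even_two_mul _).neg_pow, Matrix.smul_mulVec, Matrix.smul_mulVec]
  simp
  ring

variable (A)

theorem iteratedDeriv_phi (t : ℕ → ℝ) (k : ℕ) (i : Fin N) :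
    iteratedDeriv k (fun y => phi A C y t i) =
      fun y => (1 / 2 : ℂ) ^ k * (A ^ k).mulVec (phi A C y t) i := by
  induction k with
  | zero => simp
  | succ k ih =>
    rw [iteratedDeriv_succ, ih]
    ext y
    have h : HasDerivAt (fun y => (1 / 2 : ℂ) ^ k * (A ^ k).mulVec (phi A C y t) i)
        ((1 / 2 : ℂ) ^ k * (A ^ k).mulVec (((1 / 2 : ℂ) • A).mulVec (phi A C y t)) i) y :=
      (HasDerivAt.fun_sum fun l _ =>
        (hasDerivAt_phi_space A C y t l).const_mul _).const_mul _
    rw [h.deriv, Matrix.mulVec_mulVec, Matrix.mul_smul, ← pow_succ, Matrix.smul_mulVec,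
      Pi.smul_apply, smul_eq_mul, pow_succ (1 / 2 : ℂ), mul_assoc]

theorem contDiff_phi (t : ℕ → ℝ) (i : Fin N) :
    ContDiff ℝ ((⊤ : ℕ∞) : WithTop ℕ∞) (fun y => phi A C y t i) := by
  refine contDiff_of_differentiable_iteratedDeriv fun k _ => ?_
  rw [iteratedDeriv_phi]
  refine Differentiable.const_mul (fun y => ?_) _
  exact DifferentiableAt.fun_sum (u := Finset.univ) fun l _ =>
    (hasDerivAt_phi_space A C y t l).differentiableAt.const_mul _

theorem iteratedDeriv_psi (t : ℕ → ℝ) (k : ℕ) (i : Fin N) :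
    iteratedDeriv k (fun y => psi A C y t i) =
      fun y => (-1 / 2 : ℂ) ^ k * (A ^ k).mulVec (psi A C y t) i := by
  simp only [psi_eq_phi_neg]
  rw [iteratedDeriv_phi]
  ext y
  have hk : (-A) ^ k = (-1 : ℂ) ^ k • A ^ k := by rw [← smul_pow, neg_one_smul]
  rw [hk, Matrix.smul_mulVec, Pi.smul_apply, smul_eq_mul, ← mul_assoc, ← mul_pow]
  norm_num

theorem contDiff_psi (t : ℕ → ℝ) (i : Fin N) :
    ContDiff ℝ ((⊤ : ℕ∞) : WithTop ℕ∞) (fun y => psi A C y t i) := by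
  simp only [psi_eq_phi_neg]
  exact contDiff_phi _ _ _ _

end

/-! ### The frame of `φ` and `ψ`. -/

section

variable {N : ℕ} (A : Matrix (Fin N) (Fin N) ℂ) (Cp Cm : Fin N → ℂ)

/-- The matrix with columns `φ` and `ψ`. -/
noncomputable def waveFrame (x : ℝ) (t : ℕ → ℝ) : Matrix (Fin N) (Fin 2) ℂ :=
  Matrix.of fun i => ![phi A Cp x t i, psi A Cm x t i]

theorem mul_waveFrame_zero (B : Matrix (Fin N) (Fin N) ℂ) (x : ℝ) (t : ℕ → ℝ) (i : Fin N) :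
    (B * waveFrame A Cp Cm x t) i 0 = B.mulVec (phi A Cp x t) i := rfl

theorem mul_waveFrame_one (B : Matrix (Fin N) (Fin N) ℂ) (x : ℝ) (t : ℕ → ℝ) (i : Fin N) :
    (B * waveFrame A Cp Cm x t) i 1 = B.mulVec (psi A Cm x t) i := rfl

theorem mul_halfSigma_zero (M : Matrix (Fin N) (Fin 2) ℂ) (i : Fin N) :
    (M * halfSigma) i 0 = 1 / 2 * M i 0 := by
  rw [halfSigma, Matrix.mul_diagonal, mul_comm]; rfl

theorem mul_halfSigma_one (M : Matrix (Fin N) (Fin 2) ℂ) (i : Fin N) :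
    (M * halfSigma) i 1 = -1 / 2 * M i 1 := by
  rw [halfSigma, Matrix.mul_diagonal, mul_comm, neg_div]; rfl

theorem hasDerivAt_waveFrame_space (x : ℝ) (t : ℕ → ℝ) (i : Fin N) (e : Fin 2) :
    HasDerivAt (fun y => waveFrame A Cp Cm y t i e)
      ((A ^ 1 * waveFrame A Cp Cm x t * halfSigma : Matrix _ _ ℂ) i e) x := by
  rw [pow_one]
  fin_cases e
  · refine (hasDerivAt_phi_space A Cp x t i).congr_deriv ?_
    rw [Matrix.smul_mulVec]
    exact (mul_halfSigma_zero (A * waveFrame A Cp Cm x t) i).symm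
  · refine (hasDerivAt_psi_space Cm x t i).congr_deriv ?_
    rw [Matrix.smul_mulVec]
    exact (mul_halfSigma_one (A * waveFrame A Cp Cm x t) i).symm

variable {A}

theorem hasDerivAt_waveFrame_time (x : ℝ) {t : ℕ → ℝ} (h : TimesConverge A t) (j : ℕ) (i : Fin N)
    (e : Fin 2) :
    HasDerivAt (fun s => waveFrame A Cp Cm x (Function.update t j s) i e)
      ((A ^ (2 * (j + 1)) * waveFrame A Cp Cm x t * halfSigma : Matrix _ _ ℂ) i e) (t j) := by
  fin_cases e
  · refine (hasDerivAt_phi_time Cp x h j i).congr_deriv ?_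
    rw [Matrix.smul_mulVec]
    exact (mul_halfSigma_zero (A ^ (2 * (j + 1)) * waveFrame A Cp Cm x t) i).symm
  · refine (hasDerivAt_psi_time Cm x h j i).congr_deriv ?_
    rw [Matrix.smul_mulVec]
    exact (mul_halfSigma_one (A ^ (2 * (j + 1)) * waveFrame A Cp Cm x t) i).symm

theorem contDiffAt_waveFrame (x : ℝ) (t : ℕ → ℝ) (i : Fin N) (e : Fin 2) :
    ContDiffAt ℝ ((⊤ : ℕ∞) : WithTop ℕ∞) (fun y => waveFrame A Cp Cm y t i e) x := by
  fin_cases e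
  · exact (contDiff_phi A Cp t i).contDiffAt
  · exact (contDiff_psi A Cm t i).contDiffAt

end

/-! ### Double Wronskians as Krylov determinants. -/

section

variable {n : ℕ} (A : Matrix (Fin (n + 1 + (n + 1))) (Fin (n + 1 + (n + 1))) ℂ)
  (Cp Cm : Fin (n + 1 + (n + 1)) → ℂ)

/-- The power of two, with sign, by which derivatives differ from powers of `A` in the `j`-th
column of a double Wronskian with `a` columns `φ`. -/
noncomputable def wronskScale (a j : ℕ) : ℂ :=
  if j < a then (1 / 2) ^ j else (-1 / 2) ^ (j - a)

theorem doubleWronskian_eq_prod (a : ℕ) (x : ℝ) (t : ℕ → ℝ) :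
    doubleWronskian a (fun y => phi A Cp y t) (fun y => psi A Cm y t) x =
      (∏ j : Fin (n + 1 + (n + 1)), wronskScale a j) *
        (Matrix.of fun i j : Fin (n + 1 + (n + 1)) =>
          if (j : ℕ) < a then (A ^ (j : ℕ)).mulVec (phi A Cp x t) i
          else (A ^ ((j : ℕ) - a)).mulVec (psi A Cm x t) i).det := by
  rw [← Matrix.det_mul_row, doubleWronskian]
  congr 1
  ext i j
  simp only [Matrix.of_apply, wronskScale, iteratedDeriv_phi, iteratedDeriv_psi]
  split_ifs <;> rfl

theorem prod_wronskScale_ne_zero (a : ℕ) : ∏ j : Fin (n + 1 + (n + 1)), wronskScale a j ≠ 0 := by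
  refine Finset.prod_ne_zero_iff.2 fun j _ => ?_
  unfold wronskScale
  split_ifs <;> exact pow_ne_zero _ (by norm_num)

theorem prod_wronskScale (a b : ℕ) : ∏ j ∈ Finset.range (a + b), wronskScale a j =
    (∏ j ∈ Finset.range a, (1 / 2 : ℂ) ^ j) * ∏ j ∈ Finset.range b, (-1 / 2 : ℂ) ^ j := by
  rw [Finset.prod_range_add]
  congr 1
  · exact Finset.prod_congr rfl fun j hj => if_pos (Finset.mem_range.1 hj)
  · refine Finset.prod_congr rfl fun j _ => ?_
    rw [wronskScale, if_neg (by omega), Nat.add_sub_cancel_left]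

/-- The numerator has `∂ₓ^{n+1}ψ` in place of `∂ₓⁿφ`, which changes the scale by `(-1/2)^{n+1} /
(1/2)^n`. This is the origin of the factor 2 in `q`. -/
theorem prod_wronskScale_shift : 2 * ∏ j : Fin (n + 1 + (n + 1)), wronskScale n j =
    (-1) ^ (n + 1) * ∏ j : Fin (n + 1 + (n + 1)), wronskScale (n + 1) j := by
  rw [Fin.prod_univ_eq_prod_range (wronskScale n), Fin.prod_univ_eq_prod_range (wronskScale (n + 1)),
    prod_wronskScale, show n + 1 + (n + 1) = n + (n + 2) by omega, prod_wronskScale,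
    Finset.prod_range_succ (fun j => (1 / 2 : ℂ) ^ j) n,
    Finset.prod_range_succ (fun j => (-1 / 2 : ℂ) ^ j) (n + 1)]
  have h : (-1 / 2 : ℂ) ^ (n + 1) = (-1) ^ (n + 1) * ((1 / 2) ^ n * (1 / 2)) := by
    rw [← pow_succ, ← mul_pow]; norm_num
  rw [h]
  ring

theorem krylovMatrix_waveFrame (x : ℝ) (t : ℕ → ℝ) :
    krylovMatrix A (waveFrame A Cp Cm x t) = Matrix.of fun i j : Fin (n + 1 + (n + 1)) =>
      if (j : ℕ) < n + 1 then (A ^ (j : ℕ)).mulVec (phi A Cp x t) i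
      else (A ^ ((j : ℕ) - (n + 1))).mulVec (psi A Cm x t) i := by
  ext i j
  induction j using Fin.addCases with
  | left k =>
    simp only [krylovMatrix, Matrix.of_apply, Fin.append_left, mul_waveFrame_zero, Fin.val_castAdd]
    rw [if_pos k.isLt]
  | right k =>
    simp only [krylovMatrix, Matrix.of_apply, Fin.append_right, mul_waveFrame_one, Fin.val_natAdd,
      Nat.add_sub_cancel_left]
    rw [if_neg (by omega)]

theorem wronskF_eq (x : ℝ) (t : ℕ → ℝ) : wronskF A Cp Cm x t =
    (∏ j : Fin (n + 1 + (n + 1)), wronskScale (n + 1) j) *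
      (krylovMatrix A (waveFrame A Cp Cm x t)).det := by
  rw [wronskF, doubleWronskian_eq_prod, krylovMatrix_waveFrame]

theorem det_krylovMatrix_ne_zero {x : ℝ} {t : ℕ → ℝ} (h : wronskF A Cp Cm x t ≠ 0) :
    (krylovMatrix A (waveFrame A Cp Cm x t)).det ≠ 0 := by
  rw [wronskF_eq] at h
  exact right_ne_zero_of_mul h

/-- The quotient of double Wronskians is the coefficient of `Aⁿ φ` in `Aⁿ⁺¹ ψ`. -/
theorem wronskH_div_wronskF (x : ℝ) (t : ℕ → ℝ) :
    2 * wronskH A Cp Cm x t / wronskF A Cp Cm x t =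
      krylovCoeff A (waveFrame A Cp Cm x t) 1 (Fin.castAdd _ (Fin.last n)) := by
  set c : Fin (n + 1 + (n + 1)) := Fin.castAdd _ (Fin.last n) with hc
  have hcv : (c : ℕ) = n := rfl
  have hcl : c ≤ Fin.last (n + 1 + n) := Fin.le_last _
  -- Cramer's rule puts `A^{n+1}ψ` in the place of `Aⁿφ`, whereas the numerator has it last. The
  -- cycle of length `n + 2` moving it there has sign `(-1)^{n+1}`, which cancels the sign of the
  -- scale.
  have hU : (Matrix.of fun i j : Fin (n + 1 + (n + 1)) =>
          if (j : ℕ) < n then (A ^ (j : ℕ)).mulVec (phi A Cp x t) i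
          else (A ^ ((j : ℕ) - n)).mulVec (psi A Cm x t) i) =
      ((krylovMatrix A (waveFrame A Cp Cm x t)).updateCol c
        fun i => (A ^ (n + 1) * waveFrame A Cp Cm x t) i 1).submatrix id
          (Fin.cycleIcc c (Fin.last (n + 1 + n))) := by
    ext i j
    rw [Matrix.submatrix_apply, Matrix.of_apply, id]
    rcases lt_or_ge j c with h | h
    · have hj : (j : ℕ) < n := h
      rw [Fin.cycleIcc_of_lt h, Matrix.updateCol_ne h.ne, krylovMatrix_waveFrame, Matrix.of_apply,
        if_pos hj, if_pos (by omega)]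
    · have hj : n ≤ (j : ℕ) := h
      rw [if_neg (by omega)]
      have hjl : j < Fin.last (n + 1 + n) ∨ j = Fin.last (n + 1 + n) := (Fin.le_last j).lt_or_eq
      rcases hjl with hl | rfl
      · have hv : ((j + 1 : Fin (n + 1 + (n + 1))) : ℕ) = j + 1 := Fin.val_add_one_of_lt hl
        rw [Fin.cycleIcc_of_ge_of_lt h hl, Matrix.updateCol_ne fun he => by
          rw [he, hcv] at hv; omega, krylovMatrix_waveFrame, Matrix.of_apply, hv,
          if_neg (by omega), Nat.add_sub_add_right]
      · rw [Fin.cycleIcc_of_last hcl, Matrix.updateCol_self, mul_waveFrame_one, Fin.val_last,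
          show n + 1 + n - n = n + 1 by omega]
  have hs : ((Equiv.Perm.sign (Fin.cycleIcc c (Fin.last (n + 1 + n))) : ℤ) : ℂ) =
      (-1) ^ (n + 1) := by
    rw [Fin.sign_cycleIcc_of_le hcl, hcv, Fin.val_last, show n + 1 + n - n = n + 1 by omega]
    push_cast; rfl
  rw [wronskF_eq, wronskH, doubleWronskian_eq_prod, hU, Matrix.det_permute', hs, ← mul_assoc,
    ← mul_assoc, prod_wronskScale_shift, krylovCoeff]
  have h1 : ((-1 : ℂ) ^ (n + 1)) * (-1) ^ (n + 1) = 1 := by rw [← mul_pow]; norm_num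
  rw [mul_right_comm ((-1 : ℂ) ^ (n + 1)), h1, one_mul,
    mul_div_mul_left _ _ (prod_wronskScale_ne_zero _)]

end

/-! ### The reflection `(x, t) ↦ (σx, -t)` and the solution of the hierarchy. -/

section

variable {N : ℕ} {A T : Matrix (Fin N) (Fin N) ℂ} {σ δ : ℝ}

theorem NLSConstraint.mul_eq (h : NLSConstraint σ δ A T) :
    A * T = (-σ : ℂ) • (T * A) := by
  rw [neg_smul]; exact eq_neg_of_add_eq_zero_left h.1

theorem NLSConstraint.pow_mul_eq (h : NLSConstraint σ δ A T) (k : ℕ) :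
    A ^ k * T = (-σ : ℂ) ^ k • (T * A ^ k) := by
  induction k with
  | zero => simp
  | succ k ih =>
    rw [pow_succ, Matrix.mul_assoc, h.mul_eq, Matrix.mul_smul, ← Matrix.mul_assoc, ih,
      Matrix.smul_mul, smul_smul, Matrix.mul_assoc, pow_succ, mul_comm]

/-- The reflection `ψ(x, t) = T φ(σ x, -t)`. -/
theorem NLSConstraint.psi_eq (hσ : σ = 1 ∨ σ = -1) (h : NLSConstraint σ δ A T) (C : Fin N → ℂ)
    (x : ℝ) {t : ℕ → ℝ} (ht : TimesConverge A t) :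
    psi A (T.mulVec C) x t = T.mulVec (phi A C (σ * x) (-t)) := by
  have hσ2 : (σ : ℂ) * σ = 1 := by rcases hσ with rfl | rfl <;> norm_num
  rw [phi, psi]
  refine (exp_mulVec_semiconj ?_ C).symm
  -- `T` intertwines `σA` with `-A` and commutes with even powers of `A`, since `σ² = 1`. Hence it
  -- intertwines the exponent of `φ` at `(σx, -t)` with that of `ψ` at `(x, t)`.
  have hA : SemiconjBy T ((σ : ℂ) • A) (-A) := by
    rw [SemiconjBy, neg_mul, h.mul_eq, Matrix.mul_smul, neg_smul, neg_neg]
  have hS : SemiconjBy T (∑' j, (((-t) j : ℝ) : ℂ) • A ^ (2 * (j + 1)))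
      (∑' j, -((t j : ℂ) • A ^ (2 * (j + 1)))) := by
    refine SemiconjBy.tsum_right T ht.neg (Summable.neg ht) fun j => ?_
    have hp : (-σ : ℂ) ^ (2 * (j + 1)) = 1 := by rw [pow_mul, neg_sq, sq, hσ2, one_pow]
    rw [SemiconjBy, neg_mul, Matrix.smul_mul, h.pow_mul_eq, Matrix.mul_smul, hp, one_smul]
    simp
  rw [tsum_neg] at hS
  have e1 : (1 / 2 : ℂ) • (((σ * x : ℝ) : ℂ) • A) = (1 / 2 * x : ℂ) • ((σ : ℂ) • A) := by
    push_cast; module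
  rw [e1, sub_eq_add_neg,
    show -((1 / 2 : ℂ) • ((x : ℂ) • A)) = (1 / 2 * x : ℂ) • -A by module, ← smul_neg]
  exact (hA.smul_right _).add_right (hS.smul_right _)

theorem NLSConstraint.mulVec_mulVec (h : NLSConstraint σ δ A T)
    (v : Fin N → ℂ) : T.mulVec (T.mulVec v) = ((δ * σ : ℝ) : ℂ) • v := by
  rw [Matrix.mulVec_mulVec, ← sq, h.2, Matrix.smul_mulVec, Matrix.one_mulVec]

end

section

variable {n : ℕ} {A T : Matrix (Fin (n + 1 + (n + 1))) (Fin (n + 1 + (n + 1))) ℂ} {σ δ : ℝ}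
  {Cp : Fin (n + 1 + (n + 1)) → ℂ}

/-- Reflected frames: `q(σ x, -t)` in terms of the frame at `(x, t)`. -/
theorem NLSConstraint.krylovCoeff_reflect (hσ : σ = 1 ∨ σ = -1) (hδ : δ = 1 ∨ δ = -1)
    (h : NLSConstraint σ δ A T) {Y Y' : Matrix (Fin (n + 1 + (n + 1))) (Fin 2) ℂ}
    (h0 : (fun i => Y' i 0) = ((δ * σ : ℝ) : ℂ) • T.mulVec fun i => Y i 1)
    (h1 : (fun i => Y' i 1) = T.mulVec fun i => Y i 0) (hY : (krylovMatrix A Y).det ≠ 0) :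
    (δ : ℂ) * krylovCoeff A Y' 1 (Fin.castAdd _ (Fin.last n)) =
      -krylovCoeff A Y 0 (Fin.natAdd _ (Fin.last n)) := by
  have hσ2 : (-σ : ℂ) * -σ = 1 := by rcases hσ with rfl | rfl <;> norm_num
  have hσ0 : (-σ : ℂ) ≠ 0 := left_ne_zero_of_mul (hσ2.trans_ne one_ne_zero)
  have hδσ : ((δ * σ : ℝ) : ℂ) ≠ 0 := by
    rcases hσ with rfl | rfl <;> rcases hδ with rfl | rfl <;> norm_num
  have hTinj : ∀ v, T.mulVec v = 0 → v = 0 := fun v hv => by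
    have := h.mulVec_mulVec v
    rw [hv, Matrix.mulVec_zero] at this
    exact (smul_eq_zero.1 this.symm).resolve_left hδσ
  have hpow : ∀ (k : ℕ) (v : Fin (n + 1 + (n + 1)) → ℂ), (A ^ k).mulVec (T.mulVec v) =
      (-σ : ℂ) ^ k • T.mulVec ((A ^ k).mulVec v) := fun k v => by
    rw [Matrix.mulVec_mulVec, h.pow_mul_eq, Matrix.smul_mulVec, Matrix.mulVec_mulVec]
  have hc0 : ∀ k, (fun i => (A ^ k * Y') i 0) =
      ((δ * σ : ℝ) : ℂ) • (-σ : ℂ) ^ k • T.mulVec (fun i => (A ^ k * Y) i 1) := fun k => by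
    have : (fun i => (A ^ k * Y') i 0) = (A ^ k).mulVec fun i => Y' i 0 := rfl
    rw [this, h0, Matrix.mulVec_smul, hpow]; rfl
  have hc1 : ∀ k, (fun i => (A ^ k * Y') i 1) =
      (-σ : ℂ) ^ k • T.mulVec (fun i => (A ^ k * Y) i 0) := fun k => by
    have : (fun i => (A ^ k * Y') i 1) = (A ^ k).mulVec fun i => Y' i 1 := rfl
    rw [this, h1, hpow]; rfl
  -- Up to `T`, the Krylov columns of `Y'` are those of `Y` with `φ` and `ψ` exchanged and rescaled;
  -- `R` is the corresponding substitution of coordinates. It is injective, so `Y'` is nondegenerate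
  -- too.
  let R : (Fin (n + 1 + (n + 1)) → ℂ) → (Fin (n + 1 + (n + 1)) → ℂ) := fun u =>
    Fin.append (fun k : Fin (n + 1) => (-σ : ℂ) ^ (k : ℕ) * u (Fin.natAdd _ k))
      (fun k : Fin (n + 1) => ((δ * σ : ℝ) : ℂ) * (-σ : ℂ) ^ (k : ℕ) * u (Fin.castAdd _ k))
  have hK : ∀ M : Matrix (Fin (n + 1 + (n + 1))) (Fin 2) ℂ, ∀ u, (krylovMatrix A M).mulVec u =
      ∑ k : Fin (n + 1), (u (Fin.castAdd _ k) • (fun i => (A ^ (k : ℕ) * M) i 0) +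
        u (Fin.natAdd _ k) • (fun i => (A ^ (k : ℕ) * M) i 1)) := fun M u => by
    ext i
    rw [krylovMatrix_mulVec, Finset.sum_apply]
    refine Finset.sum_congr rfl fun k _ => ?_
    simp only [Pi.add_apply, Pi.smul_apply, smul_eq_mul]
    ring
  have hR : ∀ u, (krylovMatrix A Y').mulVec u = T.mulVec ((krylovMatrix A Y).mulVec (R u)) :=
    fun u => by
    rw [hK, hK, ← Matrix.mulVecLin_apply, map_sum]
    refine Finset.sum_congr rfl fun k _ => ?_
    rw [hc0, hc1, map_add, map_smul, map_smul, Matrix.mulVecLin_apply, Matrix.mulVecLin_apply]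
    simp only [R, Fin.append_left, Fin.append_right]
    module
  have hY' : (krylovMatrix A Y').det ≠ 0 := fun hd => by
    obtain ⟨u, hu0, hu⟩ := Matrix.exists_mulVec_eq_zero_iff.2 hd
    rw [hR] at hu
    have hRu := Matrix.eq_zero_of_mulVec_eq_zero hY (hTinj _ hu)
    refine hu0 (funext fun j => ?_)
    induction j using Fin.addCases with
    | left k =>
      have := congrFun hRu (Fin.natAdd _ k)
      simp only [R, Fin.append_right, Pi.zero_apply] at this
      exact (mul_eq_zero.1 this).resolve_left (mul_ne_zero hδσ (pow_ne_zero _ hσ0))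
    | right k =>
      have := congrFun hRu (Fin.castAdd _ k)
      simp only [R, Fin.append_left, Pi.zero_apply] at this
      exact (mul_eq_zero.1 this).resolve_left (pow_ne_zero _ hσ0)
  have hu := mulVec_krylovCoeff hY' 1
  rw [hR, hc1] at hu
  have hu2 : (krylovMatrix A Y).mulVec ((-σ : ℂ) ^ (n + 1) • R (krylovCoeff A Y' 1)) =
      fun i => (A ^ (n + 1) * Y) i 0 := by
    rw [Matrix.mulVec_smul]
    refine sub_eq_zero.1 (hTinj _ ?_)
    rw [Matrix.mulVec_sub, Matrix.mulVec_smul, hu, smul_smul, ← mul_pow, hσ2, one_pow, one_smul,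
      sub_self]
  rw [← eq_krylovCoeff hY 0 hu2]
  simp only [Pi.smul_apply, smul_eq_mul, R, Fin.append_right, Fin.val_last]
  -- The factors collected by the coefficient are `(-σ)^{n+1}`, `(-σ)^n` and `δσ`; their product is
  -- `-δ`.
  have h3 : ∀ a : ℂ, a * a = 1 → a ^ (n + 1) * a ^ n * -a = -1 := fun a ha => by
    calc a ^ (n + 1) * a ^ n * -a = -((a * a) ^ n * (a * a)) := by ring
      _ = -1 := by rw [ha, one_pow, one_mul]
  have h4 := h3 (-σ) hσ2
  rw [neg_neg] at h4
  push_cast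
  linear_combination ((δ : ℂ) * krylovCoeff A Y' 1 (Fin.castAdd _ (Fin.last n))) * h4

/-- The double Wronskian quotient solves the reverse-time hierarchy. -/
theorem NLSConstraint.solves (hσ : σ = 1 ∨ σ = -1) (hδ : δ = 1 ∨ δ = -1)
    (h : NLSConstraint σ δ A T) (x : ℝ) {t : ℕ → ℝ} (ht : TimesConverge A t)
    (hF : wronskF A Cp (T.mulVec Cp) x t ≠ 0) :
    SolvesReverseTimeNLSAt σ δ (fun y s => 2 * wronskH A Cp (T.mulVec Cp) y s /
      wronskF A Cp (T.mulVec Cp) y s) x t := by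
  set Y : ℝ → (ℕ → ℝ) → Matrix (Fin (n + 1 + (n + 1))) (Fin 2) ℂ :=
    waveFrame A Cp (T.mulVec Cp)
  simp only [wronskH_div_wronskF]
  have hσσ : σ * σ = 1 := by rcases hσ with rfl | rfl <;> norm_num
  have hr : ∀ y, (krylovMatrix A (Y y t)).det ≠ 0 →
      (δ : ℂ) * krylovCoeff A (Y (σ * y) (-t)) 1 (Fin.castAdd _ (Fin.last n)) =
        -krylovCoeff A (Y y t) 0 (Fin.natAdd _ (Fin.last n)) := fun y hy => by
    refine h.krylovCoeff_reflect hσ hδ ?_ ?_ hy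
    -- Since `T² = δσ I` and `(δσ)² = 1`, the reflection formula inverts to `φ(σy, -t) = δσ T ψ(y,
    -- t)`.
    · have h1 := h.psi_eq hσ Cp y ht
      have h2 : (fun i => Y y t i 1) = psi A (T.mulVec Cp) y t := rfl
      rw [h2, h1, h.mulVec_mulVec, smul_smul]
      have : ((δ * σ : ℝ) : ℂ) * ((δ * σ : ℝ) : ℂ) = 1 := by
        rcases hσ with rfl | rfl <;> rcases hδ with rfl | rfl <;> norm_num
      rw [this, one_smul]; rfl
    · have h1 := h.psi_eq hσ Cp (σ * y) ht.neg
      rw [neg_neg, ← mul_assoc, hσσ, one_mul] at h1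
      exact h1
  have hcont : ∀ y, ContinuousAt (fun z => (krylovMatrix A (Y z t)).det) y := fun y =>
    (contDiffAt_det (contDiffAt_krylovMatrix
      (contDiffAt_waveFrame Cp (T.mulVec Cp) y t))).continuousAt
  set O : Set ℝ := {y | (krylovMatrix A (Y y t)).det ≠ 0}
  have hO : IsOpen O := isOpen_ne.preimage (continuous_iff_continuousAt.2 hcont)
  have hx : x ∈ O := det_krylovMatrix_ne_zero A Cp _ hF
  have hq : ∀ y ∈ O, ContDiffAt ℝ ((⊤ : ℕ∞) : WithTop ℕ∞)
      (fun z => krylovCoeff A (Y z t) 1 (Fin.castAdd _ (Fin.last n))) y := fun y hy =>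
    contDiffAt_krylovCoeff (contDiffAt_waveFrame Cp (T.mulVec Cp) y t) hy _ _
  -- Smoothness of `r` is taken from its expression in the frame at `(y, t)`, so the denominator at
  -- the reflected point need not be examined.
  have hr' : ∀ y ∈ O, ContDiffAt ℝ ((⊤ : ℕ∞) : WithTop ℕ∞)
      (fun z => (δ : ℂ) * krylovCoeff A (Y (σ * z) (-t)) 1 (Fin.castAdd _ (Fin.last n))) y :=
    fun y hy => (contDiffAt_krylovCoeff (contDiffAt_waveFrame Cp (T.mulVec Cp) y t) hy 0
      (Fin.natAdd _ (Fin.last n))).neg.congr_of_eventuallyEq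
        (Filter.eventually_of_mem (hO.mem_nhds hy) hr)
  have hflow : ∀ y ∈ O, ∃ W', HasCoeffDerivAt (fun z => dressing A (Y z t)) W' y ∧
      X * W' = -(dressing A (Y y t) * (dressedSigma (dressing A (Y y t)) - C halfSigma -
        X * C (coeff 1 (dressedSigma (dressing A (Y y t)))))) := fun y hy => by
    refine ⟨_, hasCoeffDerivAt_dressing (hasDerivAt_waveFrame_space A Cp (T.mulVec Cp) y t) hy, ?_⟩
    have hW := constantCoeff_dressing A (Y y t)
    set W := dressing A (Y y t)
    -- For `k = 1` the tail of `Z` begins at index 2, that is, after its first two coefficients are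
    -- removed.
    have e : dressedSigma W - C halfSigma - X * C (coeff 1 (dressedSigma W)) =
        X * (X * mk fun l => coeff (l + (1 + 1)) (dressedSigma W)) := by
      ext1 j
      rcases j with _ | _ | j
      · rw [map_sub, map_sub, coeff_zero_X_mul, coeff_zero_X_mul, coeff_zero_dressedSigma hW,
          coeff_zero_C, sub_self, sub_self]
      · rw [map_sub, map_sub, coeff_succ_X_mul, coeff_succ_X_mul, coeff_zero_X_mul, coeff_zero_C,
          coeff_C, if_neg (by omega), sub_zero, sub_self]
      · rw [map_sub, map_sub, coeff_succ_X_mul, coeff_succ_X_mul, coeff_succ_X_mul, coeff_mk,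
          coeff_C, coeff_C, if_neg (by omega), if_neg (by omega), sub_zero, sub_zero]
    rw [e, mul_neg, ← mul_assoc W X, (commute_X W).eq, mul_assoc X W, ← mul_assoc W X,
      (commute_X W).eq, mul_assoc X W]
  refine ⟨hq x hx, hr' x hx, fun j => ?_⟩
  have key := coeff_dressedSigma_eq_akns hO (fun y => constantCoeff_dressing A (Y y t)) hflow hq hr'
    (fun y _ => by rw [(coeff_one_dressing (A := A) (Y y t) 1).1, neg_neg])
    (fun y hy => by rw [hr y hy, (coeff_one_dressing (A := A) (Y y t) 0).2]) (2 * (j + 1)) x hx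
  -- The time derivative is needed only at the point `t`, for the coefficient `W₁`: it is `-Z_{k+1}`
  -- with `k = 2(j+1)`.
  have htime := hasCoeffDerivAt_dressing
    (Y := fun s => Y x (Function.update t j s)) (s := t j) (k := 2 * (j + 1))
    (fun i e => by
      simpa only [Function.update_eq_self] using
        hasDerivAt_waveFrame_time Cp (T.mulVec Cp) x ht j i e)
    (by rw [Function.update_eq_self]; exact hx) 1 0 1
  simp only [Function.update_eq_self, (coeff_one_dressing _ _).1] at htime
  have h2 := htime.neg
  simp only [Pi.neg_def, neg_neg] at h2
  refine h2.congr_deriv ?_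
  have e : coeff 1 (-(X * (dressing A (Y x t) * mk fun l => coeff (l + (2 * (j + 1) + 1))
      (dressedSigma (dressing A (Y x t)))))) =
      -coeff (2 * (j + 1) + 1) (dressedSigma (dressing A (Y x t))) := by
    rw [map_neg]
    refine congrArg Neg.neg ((coeff_succ_X_mul 0 _).trans ?_)
    rw [coeff_zero_eq_constantCoeff_apply, map_mul, constantCoeff_dressing, one_mul,
      ← coeff_zero_eq_constantCoeff_apply, coeff_mk, zero_add]
  rw [e, Matrix.neg_apply, neg_neg]
  exact key.1.symm

end

/-! ### Block matrices and the diagonal case. -/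

section

variable {m : ℕ}

theorem blockMatrix_mul (M₁ M₂ M₃ M₄ N₁ N₂ N₃ N₄ : Matrix (Fin m) (Fin m) ℂ) :
    blockMatrix M₁ M₂ M₃ M₄ * blockMatrix N₁ N₂ N₃ N₄ =
      blockMatrix (M₁ * N₁ + M₂ * N₃) (M₁ * N₂ + M₂ * N₄) (M₃ * N₁ + M₄ * N₃)
        (M₃ * N₂ + M₄ * N₄) := by
  simp only [blockMatrix, Matrix.reindex_apply, Matrix.submatrix_mul_equiv,
    Matrix.fromBlocks_multiply]

theorem blockMatrix_add (M₁ M₂ M₃ M₄ N₁ N₂ N₃ N₄ : Matrix (Fin m) (Fin m) ℂ) :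
    blockMatrix M₁ M₂ M₃ M₄ + blockMatrix N₁ N₂ N₃ N₄ =
      blockMatrix (M₁ + N₁) (M₂ + N₂) (M₃ + N₃) (M₄ + N₄) := by
  simp only [blockMatrix, Matrix.reindex_apply, ← Matrix.fromBlocks_add, Matrix.submatrix_add]
  rfl

theorem blockMatrix_smul (c : ℂ) (M₁ M₂ M₃ M₄ : Matrix (Fin m) (Fin m) ℂ) :
    c • blockMatrix M₁ M₂ M₃ M₄ = blockMatrix (c • M₁) (c • M₂) (c • M₃) (c • M₄) := by
  simp only [blockMatrix, Matrix.reindex_apply, ← Matrix.fromBlocks_smul, Matrix.submatrix_smul]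
  rfl

theorem blockMatrix_neg (M₁ M₂ M₃ M₄ : Matrix (Fin m) (Fin m) ℂ) :
    blockMatrix (-M₁) (-M₂) (-M₃) (-M₄) = -blockMatrix M₁ M₂ M₃ M₄ := by
  simpa using (blockMatrix_smul (-1) M₁ M₂ M₃ M₄).symm

theorem blockMatrix_zero : blockMatrix (0 : Matrix (Fin m) (Fin m) ℂ) 0 0 0 = 0 := by
  simp [blockMatrix]

theorem blockMatrix_one : blockMatrix (1 : Matrix (Fin m) (Fin m) ℂ) 0 0 1 = 1 := by
  simp [blockMatrix]

theorem blockMatrix_mulVec (P Q : Matrix (Fin m) (Fin m) ℂ) (u v : Fin m → ℂ) :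
    (blockMatrix P 0 0 Q).mulVec (Fin.append u v) = Fin.append (P.mulVec u) (Q.mulVec v) := by
  ext i
  induction i using Fin.addCases <;>
    simp [-Fin.natAdd_eq_addNat, blockMatrix, Matrix.mulVec, dotProduct, Fin.sum_univ_add]

theorem blockConstraint (K : Matrix (Fin m) (Fin m) ℂ) :
    NLSConstraint 1 (-1) (blockMatrix K 0 0 (-K)) (blockMatrix 0 (-1) 1 0) ∧
    NLSConstraint 1 1 (blockMatrix K 0 0 (-K)) (blockMatrix 0 1 1 0) ∧
    NLSConstraint (-1) (-1) (blockMatrix K 0 0 (-K)) (blockMatrix 1 0 0 (-1)) ∧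
    NLSConstraint (-1) 1 (blockMatrix K 0 0 (-K))
      (blockMatrix (Complex.I • 1) 0 0 (-(Complex.I • 1))) := by
  refine ⟨⟨?_, ?_⟩, ⟨?_, ?_⟩, ⟨?_, ?_⟩, ⟨?_, ?_⟩⟩ <;>
    simp [sq, blockMatrix_mul, blockMatrix_add, blockMatrix_zero, ← blockMatrix_one, smul_smul,
      ← blockMatrix_neg]

/-- Block diagonal matrices with two blocks, as a ring homomorphism. -/
noncomputable def blockHom (m : ℕ) : Matrix (Fin m) (Fin m) ℂ × Matrix (Fin m) (Fin m) ℂ →+*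
    Matrix (Fin (m + m)) (Fin (m + m)) ℂ where
  toFun p := blockMatrix p.1 0 0 p.2
  map_one' := blockMatrix_one
  map_mul' p q := by simp [blockMatrix_mul]
  map_zero' := blockMatrix_zero
  map_add' p q := by simp [blockMatrix_add]

theorem continuous_blockHom : Continuous (blockHom m) :=
  (continuous_fst.matrix_fromBlocks continuous_const continuous_const
    continuous_snd).matrix_reindex _ _

theorem blockMatrix_pow (P Q : Matrix (Fin m) (Fin m) ℂ) (k : ℕ) :
    blockMatrix P 0 0 Q ^ k = blockMatrix (P ^ k) 0 0 (Q ^ k) :=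
  (map_pow (blockHom m) (P, Q) k).symm

open scoped Matrix.Norms.Operator in
theorem exp_blockMatrix (P Q : Matrix (Fin m) (Fin m) ℂ) :
    NormedSpace.exp (blockMatrix P 0 0 Q) =
      blockMatrix (NormedSpace.exp P) 0 0 (NormedSpace.exp Q) := by
  have h := NormedSpace.map_exp (blockHom m) continuous_blockHom (P, Q)
  have h1 : NormedSpace.exp (P, Q) = (NormedSpace.exp P, NormedSpace.exp Q) :=
    Prod.ext (Prod.fst_exp _) (Prod.snd_exp _)
  exact h.symm.trans (congrArg (blockHom m) h1)

/-- The flow of `diag(K, -K)` splits into two flows of `K`. -/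
theorem phi_blockMatrix {K : Matrix (Fin m) (Fin m) ℂ} {t : ℕ → ℝ} (h : TimesConverge K t)
    (u v : Fin m → ℂ) (x : ℝ) : phi (blockMatrix K 0 0 (-K)) (Fin.append u v) x t =
      Fin.append (phi K u x t) (phi K v (-x) t) := by
  have hs : HasSum (fun j => (t j : ℂ) • blockMatrix K 0 0 (-K) ^ (2 * (j + 1)))
      (blockMatrix (∑' j, (t j : ℂ) • K ^ (2 * (j + 1))) 0 0
        (∑' j, (t j : ℂ) • K ^ (2 * (j + 1)))) := by
    refine ((h.hasSum.prodMk h.hasSum).map (blockHom m) continuous_blockHom).congr_fun fun j => ?_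
    simp only [blockMatrix_pow, blockMatrix_smul, (even_two_mul _).neg_pow, smul_zero]
    rfl
  rw [phi, phi, phi, hs.tsum_eq, blockMatrix_smul, blockMatrix_smul, blockMatrix_smul,
    blockMatrix_add]
  simp only [smul_zero, add_zero]
  rw [exp_blockMatrix, blockMatrix_mulVec]
  simp

theorem timesConverge_of_blockMatrix {K : Matrix (Fin m) (Fin m) ℂ} {t : ℕ → ℝ}
    (h : TimesConverge (blockMatrix K 0 0 (-K)) t) : TimesConverge K t := by
  have hc : Continuous fun M : Matrix (Fin (m + m)) (Fin (m + m)) ℂ =>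
      M.submatrix (Fin.castAdd m) (Fin.castAdd m) := continuous_id.matrix_submatrix _ _
  let L : Matrix (Fin (m + m)) (Fin (m + m)) ℂ →+ Matrix (Fin m) (Fin m) ℂ :=
    { toFun := fun M => M.submatrix (Fin.castAdd m) (Fin.castAdd m)
      map_zero' := rfl
      map_add' := fun _ _ => rfl }
  refine (Summable.map h L hc).congr fun j => ?_
  ext a b
  change ((t j : ℂ) • blockMatrix K 0 0 (-K) ^ (2 * (j + 1))) (Fin.castAdd m a) (Fin.castAdd m b) = _
  rw [blockMatrix_pow]
  simp [blockMatrix]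

theorem phi_diagonal {k c : Fin m → ℂ} {t : ℕ → ℝ} (h : TimesConverge (Matrix.diagonal k) t)
    (x : ℝ) : phi (Matrix.diagonal k) c x t = fun i => c i * Complex.exp (zeta x t (k i)) := by
  have hd : ∀ j, (t j : ℂ) • Matrix.diagonal k ^ (2 * (j + 1)) =
      Matrix.diagonal fun i => k i ^ (2 * (j + 1)) * t j := fun j => by
    rw [Matrix.diagonal_pow, ← Matrix.diagonal_smul]
    congr 1
    ext i
    simp [mul_comm]
  have hs : Summable fun j => fun i => k i ^ (2 * (j + 1)) * (t j : ℂ) := by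
    have h1 : Summable fun j => Matrix.diagonal fun i => k i ^ (2 * (j + 1)) * (t j : ℂ) :=
      Summable.congr h hd
    simpa using h1.matrix_diag
  rw [phi]
  simp only [hd]
  rw [← Matrix.diagonal_tsum, ← Matrix.diagonal_smul, ← Matrix.diagonal_smul,
    ← Matrix.diagonal_smul, Matrix.diagonal_add, Matrix.exp_diagonal]
  ext i
  rw [Matrix.mulVec_diagonal, Pi.coe_exp, mul_comm, ← Complex.exp_eq_exp_ℂ, zeta]
  simp only [Pi.smul_apply, smul_eq_mul]
  rw [tsum_apply hs]
  congr 3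
  ring

theorem zeta_neg (x : ℝ) (t : ℕ → ℝ) (k : ℂ) : zeta x t (-k) = zeta (-x) t k := by
  simp [zeta, (even_two_mul _).neg_pow]

end

/-! ### Jordan blocks and columns of Taylor coefficients. -/

section

/-- Leibniz: at `k` only the first derivative of `κ - k` survives. For `i = 0` the truncated `i - 1`
is harmless because of the factor `i`. -/
theorem iteratedDeriv_sub_mul {f : ℂ → ℂ} {k : ℂ} (hf : AnalyticAt ℂ f k) (i : ℕ) :
    iteratedDeriv i (fun κ => (κ - k) * f κ) k = i * iteratedDeriv (i - 1) f k := by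
  induction i generalizing f with
  | zero => simp
  | succ i ih =>
    have hd : deriv (fun κ => (κ - k) * f κ) =ᶠ[nhds k] f + fun κ => (κ - k) * deriv f κ := by
      filter_upwards [hf.eventually_analyticAt] with κ hκ
      have := ((hasDerivAt_id κ).sub_const k).mul hκ.differentiableAt.hasDerivAt
      exact this.deriv.trans (by simp)
    have ha : AnalyticAt ℂ (fun κ => (κ - k) * deriv f κ) k :=
      (analyticAt_id.sub analyticAt_const).mul hf.deriv
    rw [iteratedDeriv_succ', hd.iteratedDeriv_eq, iteratedDeriv_add hf.contDiffAt ha.contDiffAt,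
      ih hf.deriv]
    cases i with
    | zero => simp
    | succ i =>
      rw [Nat.add_sub_cancel, Nat.add_sub_cancel, ← iteratedDeriv_succ']
      push_cast
      ring

theorem iteratedDeriv_id_mul {f : ℂ → ℂ} {k : ℂ} (hf : AnalyticAt ℂ f k) (i : ℕ) :
    iteratedDeriv i (fun κ => κ * f κ) k =
      k * iteratedDeriv i f k + i * iteratedDeriv (i - 1) f k := by
  have e : (fun κ => κ * f κ) = (fun κ => k * f κ) + fun κ => (κ - k) * f κ := by
    ext κ; simp; ring
  have h1 : AnalyticAt ℂ (fun κ => k * f κ) k := analyticAt_const.mul hf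
  have h2 : AnalyticAt ℂ (fun κ => (κ - k) * f κ) k :=
    (analyticAt_id.sub analyticAt_const).mul hf
  rw [e, iteratedDeriv_add h1.contDiffAt h2.contDiffAt, iteratedDeriv_const_mul_field,
    iteratedDeriv_sub_mul hf]

/-- Write `κ = k + (κ - k)`: multiplication by `κ - k` shifts Taylor coefficients by one place,
which is the subdiagonal. -/
theorem jordanBlock_mulVec_taylorColumn {f : ℂ → ℂ} {k : ℂ} (hf : AnalyticAt ℂ f k) (m : ℕ) :
    (jordanBlock m k).mulVec (taylorColumn m f k) = taylorColumn m (fun κ => κ * f κ) k := by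
  ext i
  have hfac : ∀ j : ℕ, (Nat.factorial j : ℂ) ≠ 0 := fun j => by exact_mod_cast j.factorial_ne_zero
  have hs : (jordanBlock m k).mulVec (taylorColumn m f k) i = k * taylorColumn m f k i +
      ∑ j : Fin m, if (i : ℕ) = j + 1 then taylorColumn m f k j else 0 := by
    have h1 : k * taylorColumn m f k i =
        ∑ j, if i = j then k * taylorColumn m f k j else 0 := by simp
    rw [h1, ← Finset.sum_add_distrib]
    change ∑ j, jordanBlock m k i j * taylorColumn m f k j = _
    refine Finset.sum_congr rfl fun j _ => ?_
    simp only [jordanBlock, Matrix.of_apply]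
    by_cases h : i = j
    · subst h; simp
    · by_cases h2 : (i : ℕ) = j + 1 <;> simp [h, h2]
  rw [hs]
  simp only [taylorColumn]
  rw [iteratedDeriv_id_mul hf]
  obtain ⟨i, hi⟩ := i
  cases i with
  | zero => simp
  | succ i =>
    rw [Finset.sum_eq_single (⟨i, by omega⟩ : Fin m)]
    rotate_left
    · exact fun j _ hj => if_neg fun h => hj (Fin.ext (Nat.succ_injective (h : i + 1 = _)).symm)
    · exact fun h => absurd (Finset.mem_univ _) h
    simp only [if_true, Nat.add_sub_cancel, Nat.factorial_succ]
    push_cast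
    have := hfac i
    have : (i + 1 : ℂ) ≠ 0 := by exact_mod_cast i.succ_ne_zero
    field_simp

theorem jordanBlock_pow_mulVec_taylorColumn {f : ℂ → ℂ} {k : ℂ} (hf : AnalyticAt ℂ f k) (m p : ℕ) :
    (jordanBlock m k ^ p).mulVec (taylorColumn m f k) =
      taylorColumn m (fun κ => κ ^ p * f κ) k := by
  induction p with
  | zero => simp
  | succ p ih =>
    have ha : AnalyticAt ℂ (fun κ => κ ^ p * f κ) k := (analyticAt_id.pow p).mul hf
    rw [pow_succ', ← Matrix.mulVec_mulVec, ih, jordanBlock_mulVec_taylorColumn ha]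
    simp only [pow_succ', mul_assoc]

theorem iteratedDeriv_sub_pow (k : ℂ) (l i : ℕ) :
    iteratedDeriv i (fun κ : ℂ => (κ - k) ^ l) k = if i = l then (l.factorial : ℂ) else 0 := by
  induction l generalizing i with
  | zero => cases i <;> simp [iteratedDeriv_const]
  | succ l ih =>
    have ha : AnalyticAt ℂ (fun κ : ℂ => (κ - k) ^ l) k :=
      (analyticAt_id.sub analyticAt_const).pow l
    simp only [pow_succ']
    rw [iteratedDeriv_sub_mul ha, ih]
    cases i with
    | zero => simp
    | succ i =>
      by_cases h : i = l
      · subst h; simp [Nat.factorial_succ]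
      · simp [h]

/-- Taylor columns thus include the standard basis, so matrix entries can be read off from the
action on them. -/
theorem taylorColumn_sub_pow {m : ℕ} (k : ℂ) (l : Fin m) :
    taylorColumn m (fun κ => (κ - k) ^ (l : ℕ)) k = Pi.single l 1 := by
  ext i
  rw [taylorColumn, iteratedDeriv_sub_pow]
  by_cases h : i = l
  · subst h; simp [Nat.factorial_ne_zero]
  · simp [h, Fin.val_inj]

/-- Provides a point of convergence farther from 0 than `k`, whose terms dominate the series in `ζ`
uniformly near `k`. -/
theorem exists_norm_lt_of_eventually {p : ℂ → Prop} {k : ℂ} (h : ∀ᶠ κ in nhds k, p κ) :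
    ∃ κ, ‖k‖ < ‖κ‖ ∧ p κ := by
  obtain ⟨ε, hε, hp⟩ := Metric.eventually_nhds_iff.1 h
  by_cases hk : k = 0
  · refine ⟨((ε / 2 : ℝ) : ℂ), ?_, hp ?_⟩
    · simp [hk, hε.ne']
    · rw [hk, dist_zero_right, Complex.norm_real, Real.norm_eq_abs, abs_of_pos (by positivity)]
      linarith
  · have hk' : 0 < ‖k‖ := norm_pos_iff.2 hk
    refine ⟨((1 + ε / (2 * ‖k‖) : ℝ) : ℂ) * k, ?_, hp ?_⟩
    · rw [norm_mul, Complex.norm_real, Real.norm_eq_abs, abs_of_pos (by positivity)]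
      have : 0 < ε / (2 * ‖k‖) := by positivity
      nlinarith
    · rw [dist_eq_norm, show ((1 + ε / (2 * ‖k‖) : ℝ) : ℂ) * k - k =
        ((ε / (2 * ‖k‖) : ℝ) : ℂ) * k by push_cast; ring, norm_mul, Complex.norm_real,
        Real.norm_eq_abs, abs_of_pos (by positivity)]
      have : ε / (2 * ‖k‖) * ‖k‖ = ε / 2 := by field_simp
      linarith

theorem tendstoLocallyUniformlyOn_iteratedDeriv {ι : Type*} {φ : Filter ι} {F : ι → ℂ → ℂ}
    {f : ℂ → ℂ} {U : Set ℂ} (hU : IsOpen U) (hF : ∀ n, DifferentiableOn ℂ (F n) U)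
    (h : TendstoLocallyUniformlyOn F f φ U) (i : ℕ) :
    TendstoLocallyUniformlyOn (fun n => iteratedDeriv i (F n)) (iteratedDeriv i f) φ U := by
  have hd : ∀ n i, DifferentiableOn ℂ (iteratedDeriv i (F n)) U := fun n i => by
    induction i with
    | zero => simpa using hF n
    | succ i ih => rw [iteratedDeriv_succ]; exact ih.deriv hU
  induction i with
  | zero => simpa using h
  | succ i ih =>
    simp only [iteratedDeriv_succ]
    exact ih.deriv (Filter.Eventually.of_forall fun n => hd n i) hU

/-- Termwise differentiation of the series in `ζ`, multiplied by an analytic function. -/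
theorem hasSum_iteratedDeriv_series {t : ℕ → ℝ} {k : ℂ}
    (ht : ∀ᶠ κ in nhds k, Summable fun j => κ ^ (2 * (j + 1)) * (t j : ℂ)) {f : ℂ → ℂ}
    (hf : AnalyticAt ℂ f k) :
    AnalyticAt ℂ (fun κ => (∑' j, κ ^ (2 * (j + 1)) * (t j : ℂ)) * f κ) k ∧
    ∀ i, HasSum (fun j => iteratedDeriv i (fun κ => κ ^ (2 * (j + 1)) * (t j : ℂ) * f κ) k)
      (iteratedDeriv i (fun κ => (∑' j, κ ^ (2 * (j + 1)) * (t j : ℂ)) * f κ) k) := by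
  obtain ⟨κ₀, hκ₀, hs⟩ := exists_norm_lt_of_eventually ht
  obtain ⟨M, hM⟩ : ∃ M, ∀ᶠ κ in nhds k, ‖f κ‖ ≤ M :=
    ⟨‖f k‖ + 1, (hf.continuousAt.norm.eventually_lt continuousAt_const (by simp)).mono
      fun κ hκ => hκ.le⟩
  have hn : ∀ᶠ κ : ℂ in nhds k, ‖κ‖ < ‖κ₀‖ :=
    continuous_norm.continuousAt.eventually_lt continuousAt_const hκ₀
  obtain ⟨U, hUs, hU, hkU⟩ := eventually_nhds_iff.1
    (hM.and (hn.and hf.eventually_analyticAt))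
  have hfU : DifferentiableOn ℂ f U := fun κ hκ =>
    (hUs κ hκ).2.2.differentiableAt.differentiableWithinAt
  have hlim : TendstoUniformlyOn
      (fun (s : Finset ℕ) κ => ∑ j ∈ s, κ ^ (2 * (j + 1)) * (t j : ℂ) * f κ)
      (fun κ => ∑' j, κ ^ (2 * (j + 1)) * (t j : ℂ) * f κ) Filter.atTop U := by
    refine tendstoUniformlyOn_tsum (hs.norm.mul_right M) fun j κ hκ => ?_
    rw [norm_mul, norm_mul, norm_mul, norm_pow, norm_pow]
    obtain ⟨h1, h2, -⟩ := hUs κ hκ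
    gcongr
  simp only [tsum_mul_right] at hlim
  have hF : ∀ s : Finset ℕ,
      DifferentiableOn ℂ (fun κ => ∑ j ∈ s, κ ^ (2 * (j + 1)) * (t j : ℂ) * f κ) U := fun s => by
    fun_prop
  refine ⟨(hlim.tendstoLocallyUniformlyOn.differentiableOn (Filter.Eventually.of_forall hF)
    hU).analyticAt (hU.mem_nhds hkU), fun i => ?_⟩
  have h1 := (tendstoLocallyUniformlyOn_iteratedDeriv hU hF hlim.tendstoLocallyUniformlyOn
    i).tendsto_at hkU
  refine h1.congr fun s => ?_
  have ha : ∀ j ∈ s, ContDiffAt ℂ i (fun κ => κ ^ (2 * (j + 1)) * (t j : ℂ) * f κ) k :=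
    fun j _ => (((analyticAt_id.pow _).mul analyticAt_const).mul hf).contDiffAt
  exact iteratedDeriv_fun_sum ha

theorem hasSum_jordanBlock {t : ℕ → ℝ} {k : ℂ}
    (ht : ∀ᶠ κ in nhds k, Summable fun j => κ ^ (2 * (j + 1)) * (t j : ℂ)) (m : ℕ) :
    TimesConverge (jordanBlock m k) t ∧ ∀ f, AnalyticAt ℂ f k →
      (∑' j, (t j : ℂ) • jordanBlock m k ^ (2 * (j + 1))).mulVec (taylorColumn m f k) =
        taylorColumn m (fun κ => (∑' j, κ ^ (2 * (j + 1)) * (t j : ℂ)) * f κ) k := by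
  have key : ∀ f, AnalyticAt ℂ f k → HasSum
      (fun j => ((t j : ℂ) • jordanBlock m k ^ (2 * (j + 1))).mulVec (taylorColumn m f k))
      (taylorColumn m (fun κ => (∑' j, κ ^ (2 * (j + 1)) * (t j : ℂ)) * f κ) k) := fun f hf => by
    rw [Pi.hasSum]
    intro i
    refine (((hasSum_iteratedDeriv_series ht hf).2 i).div_const
      (Nat.factorial i : ℂ)).congr_fun fun j => ?_
    rw [Matrix.smul_mulVec, jordanBlock_pow_mulVec_taylorColumn hf, Pi.smul_apply, smul_eq_mul,
      taylorColumn, ← mul_div_assoc, ← iteratedDeriv_const_mul_field]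
    simp only [mul_left_comm, mul_assoc]
  -- Convergence of the matrix series is checked on the basis vectors, column by column.
  have hsum : TimesConverge (jordanBlock m k) t := by
    refine Pi.summable.2 fun i => Pi.summable.2 fun l => ?_
    have ha : AnalyticAt ℂ (fun κ => (κ - k) ^ (l : ℕ)) k :=
      (analyticAt_id.sub analyticAt_const).pow l
    have h1 := Pi.summable.1 (key _ ha).summable i
    rw [taylorColumn_sub_pow] at h1
    exact h1.congr fun j => by simp
  refine ⟨hsum, fun f hf => HasSum.unique ?_ (key f hf)⟩
  let L : Matrix (Fin m) (Fin m) ℂ →+ (Fin m → ℂ) :=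
    { toFun := fun M => M.mulVec (taylorColumn m f k)
      map_zero' := Matrix.zero_mulVec _
      map_add' := fun _ _ => Matrix.add_mulVec _ _ _ }
  exact hsum.hasSum.map L (continuous_id.matrix_mulVec continuous_const)

/-- Interchange of `∂_s` and `∂_κ^i`. The induction varies `c`, because `∂_κ(c e^{sg}) = c' e^{sg} +
s (c g') e^{sg}` is built from functions of the same form. -/
theorem hasDerivAt_iteratedDeriv_mul_exp {c g : ℂ → ℂ} {k : ℂ} (hc : AnalyticAt ℂ c k)
    (hg : AnalyticAt ℂ g k) (i : ℕ) (s : ℝ) :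
    HasDerivAt (fun s : ℝ => iteratedDeriv i (fun κ => c κ * Complex.exp (s * g κ)) k)
      (iteratedDeriv i (fun κ => g κ * (c κ * Complex.exp (s * g κ))) k) s := by
  have hE : ∀ s : ℝ, AnalyticAt ℂ (fun κ => Complex.exp (s * g κ)) k := fun s =>
    (analyticAt_const.mul hg).cexp
  induction i generalizing c with
  | zero =>
    simp only [iteratedDeriv_zero]
    have h1 := ((((hasDerivAt_id s).ofReal_comp.mul_const (g k)).cexp).const_mul (c k))
    refine h1.congr_deriv ?_
    simp
    ring
  | succ i ih =>
    have hcg := hc.mul hg.deriv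
    have e : ∀ s : ℝ, ∀ a : ℂ → ℂ, AnalyticAt ℂ a k → iteratedDeriv (i + 1)
        (fun κ => a κ * Complex.exp (s * g κ)) k =
        iteratedDeriv i (fun κ => deriv a κ * Complex.exp (s * g κ)) k +
        s * iteratedDeriv i (fun κ => (a κ * deriv g κ) * Complex.exp (s * g κ)) k :=
      fun s a ha => by
      have hd : deriv (fun κ => a κ * Complex.exp (s * g κ)) =ᶠ[nhds k]
          (fun κ => deriv a κ * Complex.exp (s * g κ)) +
          fun κ => (s : ℂ) * ((a κ * deriv g κ) * Complex.exp (s * g κ)) := by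
        filter_upwards [ha.eventually_analyticAt, hg.eventually_analyticAt] with κ h1 h2
        have := h1.differentiableAt.hasDerivAt.mul
          (h2.differentiableAt.hasDerivAt.const_mul (s : ℂ)).cexp
        refine this.deriv.trans ?_
        simp only [Pi.add_apply]
        ring
      have h1 : AnalyticAt ℂ (fun κ => deriv a κ * Complex.exp (s * g κ)) k := ha.deriv.mul (hE s)
      have h2 : AnalyticAt ℂ
          (fun κ => (s : ℂ) * ((a κ * deriv g κ) * Complex.exp (s * g κ))) k :=
        analyticAt_const.mul ((ha.mul hg.deriv).mul (hE s))
      rw [iteratedDeriv_succ', hd.iteratedDeriv_eq,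
        iteratedDeriv_add h1.contDiffAt h2.contDiffAt, iteratedDeriv_const_mul_field]
    have h2 := (ih hc.deriv).add ((hasDerivAt_id s).ofReal_comp.mul (ih hcg))
    have e1 : (fun s : ℝ => iteratedDeriv (i + 1) (fun κ => c κ * Complex.exp (s * g κ)) k) =
        _ := funext fun s => e s c hc
    rw [e1]
    refine h2.congr_deriv ?_
    have e2 := e s (fun κ => g κ * c κ) (hg.mul hc)
    simp only [mul_assoc] at e2 ⊢
    rw [e2]
    have hd : (fun κ => deriv (fun κ => g κ * c κ) κ * Complex.exp (s * g κ)) =ᶠ[nhds k]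
        (fun κ => g κ * (deriv c κ * Complex.exp (s * g κ))) +
        fun κ => c κ * (deriv g κ * Complex.exp (s * g κ)) := by
      filter_upwards [hc.eventually_analyticAt, hg.eventually_analyticAt] with κ h1 h2
      have := (h2.differentiableAt.hasDerivAt.mul h1.differentiableAt.hasDerivAt).deriv
      rw [show deriv (fun κ => g κ * c κ) κ = _ from this]
      simp only [Pi.add_apply]
      ring
    have h3 : AnalyticAt ℂ (fun κ => g κ * (deriv c κ * Complex.exp (s * g κ))) k :=
      hg.mul (hc.deriv.mul (hE s))
    have h4 : AnalyticAt ℂ (fun κ => c κ * (deriv g κ * Complex.exp (s * g κ))) k :=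
      hc.mul (hg.deriv.mul (hE s))
    rw [hd.iteratedDeriv_eq, iteratedDeriv_add h3.contDiffAt h4.contDiffAt]
    simp only [Pi.mul_apply, Complex.ofReal_one, one_mul, id, mul_assoc]
    ring

/-- If `B` acts on Taylor columns as multiplication by `g`, then `exp B` acts as multiplication
by `exp g`. -/
theorem exp_mulVec_taylorColumn {m : ℕ} {B : Matrix (Fin m) (Fin m) ℂ} {g c : ℂ → ℂ} {k : ℂ}
    (hg : AnalyticAt ℂ g k) (hc : AnalyticAt ℂ c k)
    (hB : ∀ f, AnalyticAt ℂ f k →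
      B.mulVec (taylorColumn m f k) = taylorColumn m (fun κ => g κ * f κ) k) :
    (NormedSpace.exp B).mulVec (taylorColumn m c k) =
      taylorColumn m (fun κ => c κ * Complex.exp (g κ)) k := by
  have hE : ∀ s : ℝ, AnalyticAt ℂ (fun κ => c κ * Complex.exp (s * g κ)) k := fun s =>
    hc.mul (analyticAt_const.mul hg).cexp
  let L : (Fin m → ℂ) →L[ℝ] (Fin m → ℂ) := (B.mulVecLin.restrictScalars ℝ).toContinuousLinearMap
  -- `exp(sB)` applied to the column of `c`, and the column of `c e^{sg}`, both solve `v' = B v` and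
  -- agree at `s = 0`; they are compared at `s = 1`.
  have huniq := ODE_solution_unique_univ (v := fun _ => L) (s := fun _ => Set.univ)
    (K := ‖L‖₊) (t₀ := 0)
    (f := fun s : ℝ => (NormedSpace.exp (0 + (s : ℂ) • B)).mulVec (taylorColumn m c k))
    (g := fun s : ℝ => taylorColumn m (fun κ => c κ * Complex.exp (s * g κ)) k)
    (fun _ => L.lipschitz.lipschitzOnWith)
    (fun s => ⟨hasDerivAt_pi.2 fun i =>
      hasDerivAt_exp_mulVec (Commute.zero_left B) _ s i, Set.mem_univ _⟩)
    (fun s => ⟨hasDerivAt_pi.2 fun i => by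
      have h1 := (hasDerivAt_iteratedDeriv_mul_exp hc hg i s).div_const (Nat.factorial i : ℂ)
      have h2 := congrFun (hB _ (hE s)) i
      exact h1.congr_deriv h2.symm, Set.mem_univ _⟩)
    (by simp)
  have := congrFun huniq 1
  simpa using this

theorem phi_jordanBlock {t : ℕ → ℝ} {k : ℂ}
    (ht : ∀ᶠ κ in nhds k, Summable fun j => κ ^ (2 * (j + 1)) * (t j : ℂ)) {c : ℂ → ℂ}
    (hc : AnalyticAt ℂ c k) (m : ℕ) (x : ℝ) :
    phi (jordanBlock m k) (taylorColumn m c k) x t =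
      taylorColumn m (fun κ => c κ * Complex.exp (zeta x t κ)) k := by
  have hS : AnalyticAt ℂ (fun κ : ℂ => ∑' j, κ ^ (2 * (j + 1)) * (t j : ℂ)) k := by
    simpa using (hasSum_iteratedDeriv_series ht (f := fun _ => 1) analyticAt_const).1
  refine exp_mulVec_taylorColumn (g := zeta x t) ?_ hc fun f hf => ?_
  · exact ((analyticAt_const.mul analyticAt_id).mul analyticAt_const).add
      (analyticAt_const.mul hS)
  · rw [Matrix.add_mulVec, Matrix.smul_mulVec, Matrix.smul_mulVec, Matrix.smul_mulVec,
      (hasSum_jordanBlock ht m).2 f hf, jordanBlock_mulVec_taylorColumn hf]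
    have h1 : AnalyticAt ℂ (fun κ => (1 / 2 * x : ℂ) * (κ * f κ)) k :=
      analyticAt_const.mul (analyticAt_id.mul hf)
    have h2 : AnalyticAt ℂ
        (fun κ => (1 / 2 : ℂ) * ((∑' j, κ ^ (2 * (j + 1)) * (t j : ℂ)) * f κ)) k :=
      analyticAt_const.mul (hS.mul hf)
    have e : (fun κ => zeta x t κ * f κ) = (fun κ => (1 / 2 * x : ℂ) * (κ * f κ)) +
        fun κ => (1 / 2 : ℂ) * ((∑' j, κ ^ (2 * (j + 1)) * (t j : ℂ)) * f κ) := by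
      ext κ
      simp only [zeta, Pi.add_apply]
      ring
    ext i
    simp only [taylorColumn, e, Pi.add_apply, Pi.smul_apply, smul_eq_mul]
    rw [iteratedDeriv_add h1.contDiffAt h2.contDiffAt, iteratedDeriv_const_mul_field,
      iteratedDeriv_const_mul_field]
    ring

end

theorem theorem2 (n : ℕ) :
    -- the solutions of the hierarchy
    (∀ σ δ : ℝ, (σ = 1 ∨ σ = -1) → (δ = 1 ∨ δ = -1) →
      ∀ (A T : Matrix (Fin (n + 1 + (n + 1))) (Fin (n + 1 + (n + 1))) ℂ)
        (Cp Cm : Fin (n + 1 + (n + 1)) → ℂ),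
        NLSConstraint σ δ A T → Cm = T.mulVec Cp →
        ∀ (x : ℝ) (t : ℕ → ℝ), TimesConverge A t →
          psi A Cm x t = T.mulVec (phi A Cp (σ * x) (-t)) ∧
          (wronskF A Cp Cm x t ≠ 0 →
            SolvesReverseTimeNLSAt σ δ
              (fun y s => 2 * wronskH A Cp Cm y s / wronskF A Cp Cm y s) x t)) ∧
    -- block solutions of the constraint, for `(σ, δ) = (1, -1), (1, 1), (-1, -1), (-1, 1)`
    (∀ K : Matrix (Fin (n + 1)) (Fin (n + 1)) ℂ,
      NLSConstraint 1 (-1) (blockMatrix K 0 0 (-K)) (blockMatrix 0 (-1) 1 0) ∧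
      NLSConstraint 1 1 (blockMatrix K 0 0 (-K)) (blockMatrix 0 1 1 0) ∧
      NLSConstraint (-1) (-1) (blockMatrix K 0 0 (-K)) (blockMatrix 1 0 0 (-1)) ∧
      NLSConstraint (-1) 1 (blockMatrix K 0 0 (-K))
        (blockMatrix (Complex.I • 1) 0 0 (-(Complex.I • 1)))) ∧
    -- `φ` for a diagonal block
    (∀ (k c d : Fin (n + 1) → ℂ) (x : ℝ) (t : ℕ → ℝ),
      TimesConverge (blockMatrix (Matrix.diagonal k) 0 0 (-Matrix.diagonal k)) t →
      phi (blockMatrix (Matrix.diagonal k) 0 0 (-Matrix.diagonal k)) (Fin.append c d) x t =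
        Fin.append (fun i => c i * Complex.exp (zeta x t (k i)))
          (fun i => d i * Complex.exp (zeta x t (-k i)))) ∧
    -- `φ` for a Jordan block, where `c` and `d` may depend on `k`
    (∀ (k : ℂ) (c d : ℂ → ℂ), AnalyticAt ℂ c k → AnalyticAt ℂ d k →
      ∀ (x : ℝ) (t : ℕ → ℝ), (∀ᶠ κ in nhds k, Summable fun j => κ ^ (2 * (j + 1)) * (t j : ℂ)) →
        phi (blockMatrix (jordanBlock (n + 1) k) 0 0 (-jordanBlock (n + 1) k))
            (Fin.append (taylorColumn (n + 1) c k) (taylorColumn (n + 1) d k)) x t =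
          Fin.append (taylorColumn (n + 1) (fun κ => c κ * Complex.exp (zeta x t κ)) k)
            (taylorColumn (n + 1) (fun κ => d κ * Complex.exp (zeta x t (-κ))) k)) := by
  refine ⟨fun σ δ hσ hδ A T Cp Cm h hC x t ht => ?_, blockConstraint, ?_, ?_⟩
  · subst hC
    exact ⟨h.psi_eq hσ Cp x ht, h.solves hσ hδ x ht⟩
  · intro k c d x t ht
    have hK := timesConverge_of_blockMatrix ht
    rw [phi_blockMatrix hK, phi_diagonal hK, phi_diagonal hK]
    simp only [zeta_neg]
  · intro k c d hc hd x t ht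
    rw [phi_blockMatrix (hasSum_jordanBlock ht (n + 1)).1, phi_jordanBlock ht hc,
      phi_jordanBlock ht hd]
    simp only [zeta_neg]
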